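/- **Setting.** Let $N,n,m$ and $\tau\ge 1$ be integers. For $i\in\{1,\dots,N\}$ let $A_i\in\mathbb R^{n\times n}$, $B_i\in\mathbb R^{n\times m}$, and let $x_1^{\mathsf d},\dots,x_N^{\mathsf d}\in\mathbb R^n$ be the desired states. Put $$G_i:=\sum_{k=0}^{\tau-1}A_i^kB_iB_i^\top(A_i^\top)^k,$$ and, when $G_i$ is invertible, $$\mathcal G_i:=(A_i^{\tau})^\top G_i^{-1}A_i^{\tau},\qquad \bar A_i:=A_i-B_iB_i^\top(A_i^\top)^{\tau-1}G_i^{-1}A_i^{\tau}.$$ For $\varepsilon>0$ and $x=(x_1,\dots,x_N)\in\mathbb R^{nN}$ let $$C_{ij}(x):=(x_i-x_j^{\mathsf d})^\top\mathcal G_i(x_i-x_j^{\mathsf d}),\qquad K_{ij}(x):=\exp(-C_{ij}(x)/\varepsilon).$$ Write $\mathbf 1$ for the vector of ones in $\mathbb R^N$ and $\oslash$ for element-wise division. For $\beta\in\mathbb R_{>0}^N$ let $$\alpha(x,\beta):=\tfrac1N\mathbf 1\oslash[K(x)\beta],\quad f(x,\beta):=\tfrac1N\mathbf 1\oslash[K(x)^\top\alpha(x,\beta)],\quad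 \tilde P(x,\beta):=\operatorname{diag}(\alpha(x,\beta))\,K(x)\operatorname{diag}(\beta).$$ Consider the discrete-time dynamics $$x_i[k+1]=\bar A_i x_i[k]+(I-\bar A_i)\,N\sum_{j=1}^N\tilde P_{ij}(x[k],\beta[k])\,x_j^{\mathsf d}\quad(i=1,\dots,N),\qquad \beta[k+1]=f(x[k+1],\beta[k])\tag{$*$}$$ on $\mathbb R^{nN}\times(\mathbb R_{>0}^N/{\sim})$, where $\beta\sim\beta'$ if and only if $\beta=r\beta'$ for some $r>0$ (quotient topology). Let $P^*(x)$ be the unique minimizer of $\sum_{i,j}C_{ij}(x)P_{ij}+\varepsilon\sum_{i,j}P_{ij}(\log P_{ij}-1)$ over the matrices $P\in\mathbb R_{\ge0}^{N\times N}$ with $P\mathbf 1=P^\top\mathbf 1=\mathbf 1/N$. For a permutation $\sigma$ of $\{1,\dots,N\}$ let $P^\sigma_{ij}:=1/N$ if $j=\sigma(i)$ and $P^\sigma_{ij}:=0$ otherwise. **Theorem.** Suppose that for every $i$ the Gramian $G_i$ is invertible and the matrix $A_i$ is invertible, and that for all $i,j$ there is $\bar u_{ij}\in\mathbb R^m$ with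 $A_ix_j^{\mathsf d}+B_i\bar u_{ij}=x_j^{\mathsf d}$. For each $\varepsilon>0$ let $(x^{\mathsf e}(\varepsilon),\beta^{\mathsf e}(\varepsilon))\in\mathbb R^{nN}\times(\mathbb R_{>0}^N/{\sim})$ be an equilibrium of $(*)$, and assume that for some $\varepsilon'>0$ the equilibrium $(x^{\mathsf e}(\varepsilon'),\beta^{\mathsf e}(\varepsilon'))$ of $(*)$ with $\varepsilon=\varepsilon'$ is isolated. Then: (i) For all sufficiently large $\varepsilon>0$, $(x^{\mathsf e}(\varepsilon),\beta^{\mathsf e}(\varepsilon))$ is locally asymptotically stable for $(*)$. (ii) Assume in addition that $x_i^{\mathsf d}\ne x_j^{\mathsf d}$ whenever $i\ne j$, and that for some permutation $\sigma$ the family converges exponentially to the target given by $\sigma$, that is, there is $c>0$ such that, as $\varepsilon\searrow0$, $$x_i^{\mathsf e}(\varepsilon)=x^{\mathsf d}_{\sigma(i)}+O(e^{-c/\varepsilon})\ \text{ for all } i,\qquad P^*(x^{\mathsf e}(\varepsilon))=P^\sigma+O(e^{-c/\varepsilon}).$$ Then for all sufficiently small $\varepsilon>0$, $(x^{\mathsf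 e}(\varepsilon),\beta^{\mathsf e}(\varepsilon))$ is locally asymptotically stable for $(*)$. -/

import Mathlib

open Filter Topology Matrix Asymptotics

/-- Data of a group of `N` discrete-time linear agents `xᵢ[k+1] = Aᵢ xᵢ[k] + Bᵢ uᵢ[k]` with states
in `ℝⁿ`, inputs in `ℝᵐ`, desired states `x₁ᵈ, …, x_Nᵈ` and a prediction horizon. -/
structure AgentSystem (N n m : ℕ) where
  /-- the state matrices -/
  A : Fin N → Matrix (Fin n) (Fin n) ℝ
  /-- the input matrices -/
  B : Fin N → Matrix (Fin n) (Fin m) ℝ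
  /-- the desired states -/
  target : Fin N → Fin n → ℝ
  /-- the prediction horizon -/
  horizon : ℕ

/-- Positive vectors in `ℝᴺ`. -/
abbrev PosVec (N : ℕ) : Type := {β : Fin N → ℝ // ∀ j, 0 < β j}

/-- Positive vectors are identified when one is a positive multiple of the other. -/
def posVecSetoid (N : ℕ) : Setoid (PosVec N) where
  r β γ := ∃ r : ℝ, 0 < r ∧ β.1 = r • γ.1
  iseqv :=
    { refl := fun β => ⟨1, one_pos, by simp⟩
      symm := by
        rintro β γ ⟨r, hr, h⟩
        exact ⟨r⁻¹, inv_pos.mpr hr, by rw [h, smul_smul, inv_mul_cancel₀ hr.ne', one_smul]⟩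
      trans := by
        rintro β γ δ ⟨r, hr, h⟩ ⟨s, hs, h'⟩
        exact ⟨r * s, mul_pos hr hs, by rw [h, h', smul_smul]⟩ }

/-- The projective cone of positive vectors, with the quotient topology. -/
abbrev ProjCone (N : ℕ) : Type := Quotient (posVecSetoid N)

namespace Sinkhorn

variable {N : ℕ}

/-- The row scaling `α = (1_N / N) ⊘ (K β)`. -/
noncomputable def rowScaling (K : Matrix (Fin N) (Fin N) ℝ) (β : Fin N → ℝ) : Fin N → ℝ :=
  fun i => (1 / (N : ℝ)) / (K *ᵥ β) i

/-- One Sinkhorn iteration `β ↦ (1_N / N) ⊘ (Kᵀ ((1_N / N) ⊘ (K β)))`. -/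
noncomputable def update (K : Matrix (Fin N) (Fin N) ℝ) (β : Fin N → ℝ) : Fin N → ℝ :=
  fun j => (1 / (N : ℝ)) / (Kᵀ *ᵥ rowScaling K β) j

/-- The matrix `diag((1_N / N) ⊘ (K β)) K diag(β)`. -/
noncomputable def plan (K : Matrix (Fin N) (Fin N) ℝ) (β : Fin N → ℝ) :
    Matrix (Fin N) (Fin N) ℝ :=
  Matrix.diagonal (rowScaling K β) * K * Matrix.diagonal β

theorem mulVec_pos {K : Matrix (Fin N) (Fin N) ℝ} (hK : ∀ i j, 0 < K i j) {β : Fin N → ℝ}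
    (hβ : ∀ j, 0 < β j) (i : Fin N) : 0 < (K *ᵥ β) i :=
  Finset.sum_pos (fun j _ => mul_pos (hK i j) (hβ j)) ⟨i, Finset.mem_univ i⟩

theorem rowScaling_pos {K : Matrix (Fin N) (Fin N) ℝ} (hK : ∀ i j, 0 < K i j) {β : Fin N → ℝ}
    (hβ : ∀ j, 0 < β j) (i : Fin N) : 0 < rowScaling K β i := by
  have hN : (0 : ℝ) < N := Nat.cast_pos.mpr (Fin.pos i)
  exact div_pos (by positivity) (mulVec_pos hK hβ i)

theorem update_pos {K : Matrix (Fin N) (Fin N) ℝ} (hK : ∀ i j, 0 < K i j) {β : Fin N → ℝ}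
    (hβ : ∀ j, 0 < β j) (j : Fin N) : 0 < update K β j := by
  have hN : (0 : ℝ) < N := Nat.cast_pos.mpr (Fin.pos j)
  exact div_pos (by positivity)
    (mulVec_pos (K := Kᵀ) (fun a b => hK b a) (fun i => rowScaling_pos hK hβ i) j)

theorem rowScaling_smul (K : Matrix (Fin N) (Fin N) ℝ) (r : ℝ) (β : Fin N → ℝ) :
    rowScaling K (r • β) = r⁻¹ • rowScaling K β := by
  funext i
  simp only [rowScaling, Matrix.mulVec_smul, Pi.smul_apply, smul_eq_mul, div_eq_mul_inv, mul_inv]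
  ring

theorem update_smul (K : Matrix (Fin N) (Fin N) ℝ) (r : ℝ) (β : Fin N → ℝ) :
    update K (r • β) = r • update K β := by
  funext j
  simp only [update, rowScaling_smul, Matrix.mulVec_smul, Pi.smul_apply, smul_eq_mul,
    div_eq_mul_inv, mul_inv, inv_inv]
  ring

theorem plan_smul (K : Matrix (Fin N) (Fin N) ℝ) {r : ℝ} (hr : 0 < r) (β : Fin N → ℝ) :
    plan K (r • β) = plan K β := by
  ext i j
  simp only [plan, rowScaling_smul, Matrix.mul_diagonal, Matrix.diagonal_mul, Pi.smul_apply,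
    smul_eq_mul]
  field_simp

/-- The Sinkhorn iteration on the projective cone. -/
noncomputable def updateProj (K : Matrix (Fin N) (Fin N) ℝ) (hK : ∀ i j, 0 < K i j) :
    ProjCone N → ProjCone N :=
  Quotient.map (fun β : PosVec N => (⟨update K β.1, update_pos hK β.2⟩ : PosVec N)) (by
    rintro β γ ⟨r, hr, h⟩
    refine ⟨r, hr, ?_⟩
    change update K β.1 = r • update K γ.1
    rw [h, update_smul])

/-- The matrix `plan K β` depends only on the class of `β`. -/
noncomputable def planProj (K : Matrix (Fin N) (Fin N) ℝ) : ProjCone N → Matrix (Fin N) (Fin N) ℝ :=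
  Quotient.lift (fun β : PosVec N => plan K β.1) (by
    rintro β γ ⟨r, hr, h⟩
    rw [h, plan_smul K hr])

/-- The coupling matrices: entrywise nonnegative with all row and column sums `1 / N`. -/
def IsCoupling (P : Matrix (Fin N) (Fin N) ℝ) : Prop :=
  (∀ i j, 0 ≤ P i j) ∧ (∀ i, ∑ j, P i j = 1 / (N : ℝ)) ∧ (∀ j, ∑ i, P i j = 1 / (N : ℝ))

/-- The entropy `H(P) = - ∑ Pᵢⱼ (log Pᵢⱼ - 1)` (with `0 log 0 = 0`). -/
noncomputable def entropy (P : Matrix (Fin N) (Fin N) ℝ) : ℝ :=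
  -∑ i, ∑ j, P i j * (Real.log (P i j) - 1)

/-- The entropic optimal transport functional `∑ Cᵢⱼ Pᵢⱼ - ε H(P)`. -/
noncomputable def entropicCost (C : Matrix (Fin N) (Fin N) ℝ) (ε : ℝ)
    (P : Matrix (Fin N) (Fin N) ℝ) : ℝ :=
  ∑ i, ∑ j, C i j * P i j - ε * entropy P

/-- `P` solves the entropic optimal transport problem with cost matrix `C`. -/
def IsEntropicOptimal (C : Matrix (Fin N) (Fin N) ℝ) (ε : ℝ)
    (P : Matrix (Fin N) (Fin N) ℝ) : Prop :=
  IsCoupling P ∧ ∀ Q, IsCoupling Q → entropicCost C ε P ≤ entropicCost C ε Q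

/-- The permutation matrix with mass `1 / N` at the entries `(i, σ i)`. -/
noncomputable def permPlan (σ : Equiv.Perm (Fin N)) : Matrix (Fin N) (Fin N) ℝ :=
  Matrix.of fun i j => if j = σ i then 1 / (N : ℝ) else 0

end Sinkhorn

namespace AgentSystem

variable {N n m : ℕ}

/-- The reachability Gramian `∑_{k < τ} Aᵢᵏ Bᵢ Bᵢᵀ (Aᵢᵀ)ᵏ`. -/
noncomputable def gramian (S : AgentSystem N n m) (i : Fin N) : Matrix (Fin n) (Fin n) ℝ :=
  ∑ k ∈ Finset.range S.horizon, S.A i ^ k * S.B i * (S.B i)ᵀ * (S.A i)ᵀ ^ k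

/-- The weight `(Aᵢ^τ)ᵀ Gᵢ⁻¹ Aᵢ^τ` of the transport cost, `Gᵢ` being the Gramian. -/
noncomputable def costWeight (S : AgentSystem N n m) (i : Fin N) : Matrix (Fin n) (Fin n) ℝ :=
  (S.A i ^ S.horizon)ᵀ * (S.gramian i)⁻¹ * S.A i ^ S.horizon

/-- The closed-loop matrix `Aᵢ - Bᵢ Bᵢᵀ (Aᵢᵀ)^(τ-1) Gᵢ⁻¹ Aᵢ^τ` (used for `τ ≥ 1`). -/
noncomputable def closedLoop (S : AgentSystem N n m) (i : Fin N) : Matrix (Fin n) (Fin n) ℝ :=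
  S.A i - S.B i * (S.B i)ᵀ * (S.A i)ᵀ ^ (S.horizon - 1) * (S.gramian i)⁻¹ * S.A i ^ S.horizon

/-- The transport costs: the squared weighted distance from `xᵢ` to the `j`-th desired state. -/
noncomputable def costMatrix (S : AgentSystem N n m) (x : Fin N → Fin n → ℝ) :
    Matrix (Fin N) (Fin N) ℝ :=
  Matrix.of fun i j => (x i - S.target j) ⬝ᵥ (S.costWeight i *ᵥ (x i - S.target j))

/-- The Gibbs kernel `Kᵢⱼ(x) = exp(-Cᵢⱼ(x) / ε)`. -/
noncomputable def gibbs (S : AgentSystem N n m) (ε : ℝ) (x : Fin N → Fin n → ℝ) :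
    Matrix (Fin N) (Fin N) ℝ :=
  Matrix.of fun i j => Real.exp (-(S.costMatrix x i j) / ε)

theorem gibbs_pos (S : AgentSystem N n m) (ε : ℝ) (x : Fin N → Fin n → ℝ) (i j : Fin N) :
    0 < S.gibbs ε x i j := Real.exp_pos _

/-- The barycentric temporary target `N ∑ⱼ Pᵢⱼ xⱼᵈ` of agent `i`. -/
noncomputable def tempTarget (S : AgentSystem N n m) (P : Matrix (Fin N) (Fin N) ℝ) (i : Fin N) :
    Fin n → ℝ :=
  (N : ℝ) • ∑ j, P i j • S.target j

/-- The next agent states,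
`xᵢ⁺ = closedLoopᵢ xᵢ + (I - closedLoopᵢ) (temporary target of i for the plan of (x, β))`. -/
noncomputable def nextState (S : AgentSystem N n m) (ε : ℝ) (x : Fin N → Fin n → ℝ)
    (β : ProjCone N) : Fin N → Fin n → ℝ :=
  fun i => S.closedLoop i *ᵥ x i +
    (1 - S.closedLoop i) *ᵥ S.tempTarget (Sinkhorn.planProj (S.gibbs ε x) β) i

/-- The joint dynamics on `ℝ^{nN} × (ℝ_{>0}^N / ∼)`: the agents move first, then `β` is updated by
one Sinkhorn iteration with the kernel at the new agent states. -/
noncomputable def dynamics (S : AgentSystem N n m) (ε : ℝ)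
    (z : (Fin N → Fin n → ℝ) × ProjCone N) : (Fin N → Fin n → ℝ) × ProjCone N :=
  (S.nextState ε z.1 z.2,
    Sinkhorn.updateProj (S.gibbs ε (S.nextState ε z.1 z.2))
      (S.gibbs_pos ε (S.nextState ε z.1 z.2)) z.2)

/-- The horizon is positive, all reachability Gramians are invertible, and each desired state can be
made an equilibrium of each agent by a constant input. -/
def Reachable (S : AgentSystem N n m) : Prop :=
  0 < S.horizon ∧ (∀ i, IsUnit (S.gramian i)) ∧
    ∀ i j, ∃ u : Fin m → ℝ, S.A i *ᵥ S.target j + S.B i *ᵥ u = S.target j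

/-- A family, indexed by `ε > 0`, of equilibria of the joint dynamics. -/
def IsEquilibriumFamily (S : AgentSystem N n m)
    (z : ℝ → (Fin N → Fin n → ℝ) × ProjCone N) : Prop :=
  ∀ ε : ℝ, 0 < ε → S.dynamics ε (z ε) = z ε

/-- As `ε` decreases to `0`, the agent states of the equilibria converge to the permuted desired
states, and the solutions of the entropic optimal transport problem at these states converge to the
permutation matrix of `σ`, both exponentially, that is, with errors `O(exp(-c / ε))`, `c > 0`. -/
def ConvergesExponentially (S : AgentSystem N n m)
    (z : ℝ → (Fin N → Fin n → ℝ) × ProjCone N) (σ : Equiv.Perm (Fin N)) : Prop :=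
  ∃ P : ℝ → Matrix (Fin N) (Fin N) ℝ,
    (∀ ε : ℝ, 0 < ε → Sinkhorn.IsEntropicOptimal (S.costMatrix (z ε).1) ε (P ε)) ∧
    ∃ c : ℝ, 0 < c ∧
      (∀ i l, (fun ε => (z ε).1 i l - S.target (σ i) l) =O[𝓝[>] 0] fun ε => Real.exp (-c / ε)) ∧
      (∀ i j, (fun ε => P ε i j - Sinkhorn.permPlan σ i j) =O[𝓝[>] 0] fun ε => Real.exp (-c / ε))

end AgentSystem

/-- `z` is an isolated fixed point of `F`. -/
def IsIsolatedEquilibrium {Z : Type*} [TopologicalSpace Z] (F : Z → Z) (z : Z) : Prop :=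
  F z = z ∧ ∃ U ∈ 𝓝 z, ∀ w ∈ U, F w = w → w = z

/-- `z` is a locally asymptotically stable equilibrium of `z[k+1] = F(z[k])`: a fixed point that is
Lyapunov stable and attracts all trajectories that start near it. -/
def IsLocallyAsymptoticallyStable {Z : Type*} [TopologicalSpace Z] (F : Z → Z) (z : Z) : Prop :=
  F z = z ∧
  (∀ U ∈ 𝓝 z, ∃ V ∈ 𝓝 z, ∀ w ∈ V, ∀ k : ℕ, F^[k] w ∈ U) ∧
  ∃ V ∈ 𝓝 z, ∀ w ∈ V, Tendsto (fun k : ℕ => F^[k] w) atTop (𝓝 z)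

/-! Stability is proved by linearizing at the equilibrium. With `b = log β` the dynamics lift to a
smooth map `logDynamics` on a vector space. It is semiconjugate to `dynamics` through a continuous
open map, so stability descends. Centring the output makes equilibria lift to fixed points and
annihilates the scaling direction in the linearization.

At an equilibrium the softmax plan `Q` is doubly stochastic. Each state is the `Q`-barycentre of the
targets, since one is not an eigenvalue of the closed loop. The linearization then couples two
contracting parts. The agents, driven by the variation `t` of their temporary targets, have an
input-to-state quadratic Lyapunov function built from minimum control energies (`exists_lyapunov`).
The logarithms undergo the averaging `β ↦ Qᵀ(Qβ)` with an error from the cost derivative, which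
lowers the squared norm by the row variance of `β` up to that error (`sum_sq_average_le`).

Both couplings are controlled by the spread `D` of the targets around the states under `Q`. The
error fed to the logarithms is at most a constant times `(2/ε)² D` times the squared norm of the new
states, and the squared norm of `t` is at most a constant times `D (variance + (2/ε)² D |ξ|²)`.
Hence `κ ∑ Hᵢ(ξᵢ) + |β|²` decreases strictly once `κ` is small relative to a bound on `D` and then
`(2/ε) D` and `(2/ε)² D` are small (`exists_stable_of_spread_le`). For large `ε` this holds because
`D` is bounded. For small `ε` it holds because `D` is exponentially small: the equilibrium plan is
the entropic optimum (`IsEntropicOptimal.eq_softPlan`), so the assumed convergence bounds its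
entries off the permutation. -/

/-! ### Stability by linearization, and its descent to quotients -/

/-- On a finite-dimensional space, a continuous function that is homogeneous of degree two is
dominated by every positive such function. -/
theorem exists_le_mul_of_homogeneous {E : Type*} [NormedAddCommGroup E] [NormedSpace ℝ E]
    [FiniteDimensional ℝ E] {f g : E → ℝ} (hf : Continuous f) (hg : Continuous g)
    (hfh : ∀ (t : ℝ) v, f (t • v) = t ^ 2 * f v) (hgh : ∀ (t : ℝ) v, g (t • v) = t ^ 2 * g v)
    (hpos : ∀ v, v ≠ 0 → 0 < g v) : ∃ C : ℝ, 1 ≤ C ∧ ∀ v, f v ≤ C * g v := by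
  have : ProperSpace E := FiniteDimensional.proper_real E
  have hne : ∀ v ∈ Metric.sphere (0 : E) 1, v ≠ 0 := by
    rintro v hv rfl
    simp at hv
  -- By homogeneity only the unit sphere matters, and there the quotient is continuous on a compact
  -- set.
  obtain ⟨C, hC⟩ := (isCompact_sphere (0 : E) 1).exists_bound_of_continuousOn
    (f := fun v => f v / g v)
    (hf.continuousOn.div hg.continuousOn fun v hv => (hpos v (hne v hv)).ne')
  refine ⟨max C 1, le_max_right _ _, fun v => ?_⟩
  by_cases hv : v = 0
  · have h1 := hfh 0 0
    have h2 := hgh 0 0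
    simp at h1 h2
    simp [hv, h1, h2]
  · have hn : 0 < ‖v‖ := norm_pos_iff.mpr hv
    set u := ‖v‖⁻¹ • v with hu
    have hus : u ∈ Metric.sphere (0 : E) 1 := by
      simp [hu, norm_smul, hn.ne']
    have hvu : v = ‖v‖ • u := by rw [hu, smul_smul, mul_inv_cancel₀ hn.ne', one_smul]
    have hb := (le_abs_self _).trans ((Real.norm_eq_abs _).symm.le.trans (hC u hus))
    have hgu := hpos u (hne u hus)
    have hfu : f u ≤ max C 1 * g u :=
      ((div_le_iff₀ hgu).mp hb).trans (mul_le_mul_of_nonneg_right (le_max_left _ _) hgu.le)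
    rw [hvu, hfh, hgh]
    calc ‖v‖ ^ 2 * f u ≤ ‖v‖ ^ 2 * (max C 1 * g u) := by gcongr
      _ = _ := by ring

/-- Stability of a fixed point by linearization, with a Lyapunov function for the derivative that is
homogeneous of degree two. -/
theorem isLocallyAsymptoticallyStable_of_hasFDerivAt {E : Type*} [NormedAddCommGroup E]
    [NormedSpace ℝ E] [FiniteDimensional ℝ E] {F : E → E} {z : E} {L : E →L[ℝ] E}
    (hF : HasFDerivAt F L z) (hz : F z = z) {W : E → ℝ} (hW : Continuous W)
    (hWh : ∀ (t : ℝ) v, W (t • v) = t ^ 2 * W v) (hpos : ∀ v, v ≠ 0 → 0 < W v)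
    (hdec : ∀ v, v ≠ 0 → W (L v) < W v) : IsLocallyAsymptoticallyStable F z := by
  have : ProperSpace E := FiniteDimensional.proper_real E
  have hW0 : W 0 = 0 := by simpa using hWh 0 0
  have hWnn : ∀ v, 0 ≤ W v := fun v => by
    by_cases hv : v = 0
    · simp [hv, hW0]
    · exact (hpos v hv).le
  obtain ⟨C, hC1, hC⟩ := exists_le_mul_of_homogeneous (f := W) (g := fun v => W v - W (L v)) hW
    (hW.sub (hW.comp L.continuous)) hWh (fun t v => by simp only [map_smul, hWh]; ring)
    (fun v hv => sub_pos.mpr (hdec v hv))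
  obtain ⟨A, hA1, hA⟩ := exists_le_mul_of_homogeneous (f := fun v : E => ‖v‖ ^ 2) (g := W)
    (by fun_prop) hW (fun t v => by rw [norm_smul, mul_pow, Real.norm_eq_abs, sq_abs]) hWh hpos
  have hC0 : 0 < C := by linarith
  have hA0 : 0 < A := by linarith
  -- The linear map decreases `W` by the factor `1 - 1/C`; giving up half of this decrease leaves
  -- room for the nonlinear remainder. `1 ≤ C` keeps `ρ` nonnegative.
  set ρ : ℝ := 1 - 1 / (2 * C) with hρ
  have hρ1 : ρ < 1 := by rw [hρ]; linarith [show 0 < 1 / (2 * C) by positivity]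
  have hρ0 : 0 ≤ ρ := by
    have : 1 / (2 * C) ≤ 1 := by rw [div_le_one (by positivity)]; linarith
    rw [hρ]; linarith
  have hL : ∀ v, v ≠ 0 → W (L v) < ρ * W v := fun v hv => by
    have h1 : W v / C ≤ W v - W (L v) := by
      rw [div_le_iff₀ hC0, mul_comm]; exact hC v
    have h2 : ρ * W v = W v - W v / C / 2 := by rw [hρ]; field_simp
    have h3 : 0 < W v / C := div_pos (hpos v hv) hC0
    rw [h2]; linarith
  have hne : ∀ v ∈ Metric.sphere (0 : E) 1, v ≠ 0 := by
    rintro v hv rfl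
    simp at hv
  -- Compactness of the sphere makes the admissible perturbation uniform in direction; scaling then
  -- turns it into a bound relative to `‖v‖`.
  have htube : ∀ᶠ r in 𝓝 (0 : E), ∀ v ∈ Metric.sphere (0 : E) 1, W (L v + r) < ρ * W v := by
    refine (isCompact_sphere (0 : E) 1).eventually_forall_of_forall_eventually fun v hv => ?_
    have hc1 : Continuous fun p : E × E => W (L p.2 + p.1) := by fun_prop
    have hc2 : Continuous fun p : E × E => ρ * W p.2 := by fun_prop
    exact hc1.continuousAt.eventually_lt hc2.continuousAt (by simpa using hL v (hne v hv))
  obtain ⟨η, hη0, hη⟩ := Metric.eventually_nhds_iff.mp htube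
  have hpert : ∀ v r : E, ‖r‖ ≤ η / 2 * ‖v‖ → W (L v + r) ≤ ρ * W v := by
    intro v r hr
    by_cases hv : v = 0
    · subst hv
      have : r = 0 := by simpa using hr
      simp [this, hW0]
    · have hn : 0 < ‖v‖ := norm_pos_iff.mpr hv
      have h := hη (y := ‖v‖⁻¹ • r) (by
        rw [dist_zero_right, norm_smul, norm_inv, norm_norm]
        calc ‖v‖⁻¹ * ‖r‖ ≤ ‖v‖⁻¹ * (η / 2 * ‖v‖) := by gcongr
          _ = η / 2 := by field_simp
          _ < η := by linarith) (‖v‖⁻¹ • v) (by simp [norm_smul, hn.ne'])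
      rw [map_smul, ← smul_add, hWh, hWh] at h
      have h2 : 0 < ‖v‖⁻¹ ^ 2 := by positivity
      refine (lt_of_mul_lt_mul_left ?_ h2.le).le
      calc _ < _ := h
        _ = _ := by ring
  have hlocal : ∀ᶠ w in 𝓝 z, W (F w - z) ≤ ρ * W (w - z) := by
    have := (hasFDerivAt_iff_isLittleO.mp hF).def (c := η / 2) (by positivity)
    filter_upwards [this] with w hw
    have h := hpert (w - z) _ hw
    rwa [show L (w - z) + (F w - F z - L (w - z)) = F w - z by rw [hz]; abel] at h
  obtain ⟨δ, hδ0, hδ⟩ := Metric.eventually_nhds_iff.mp hlocal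
  -- Sublevel sets of `W` replace balls: trajectories cannot leave them, whereas the norm itself may
  -- grow at first.
  have hsub : ∀ (r : ℝ), 0 < r → ∀ w, W (w - z) < r ^ 2 / A → dist w z < r := by
    intro r hr w hw
    rw [dist_eq_norm]
    refine lt_of_pow_lt_pow_left₀ 2 hr.le ((hA (w - z)).trans_lt ?_)
    rw [lt_div_iff₀ hA0] at hw
    linarith
  have hnhds : ∀ (r : ℝ), 0 < r → {w | W (w - z) < r ^ 2 / A} ∈ 𝓝 z := by
    intro r hr
    have hc : Continuous fun w => W (w - z) := by fun_prop
    exact hc.continuousAt.eventually_lt continuousAt_const (by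
      simp only [sub_self, hW0]; positivity)
  have hiter : ∀ w, W (w - z) < δ ^ 2 / A → ∀ k : ℕ, W (F^[k] w - z) ≤ ρ ^ k * W (w - z) := by
    intro w hw k
    induction k with
    | zero => simp
    | succ k ih =>
      have hle : ρ ^ k * W (w - z) ≤ W (w - z) :=
        mul_le_of_le_one_left (hWnn _) (pow_le_one₀ hρ0 hρ1.le)
      rw [Function.iterate_succ_apply']
      calc _ ≤ ρ * W (F^[k] w - z) := hδ (hsub δ hδ0 _ ((ih.trans hle).trans_lt hw))
        _ ≤ ρ * (ρ ^ k * W (w - z)) := by gcongr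
        _ = _ := by ring
  refine ⟨hz, fun U hU => ?_, ⟨_, hnhds δ hδ0, fun w hw => ?_⟩⟩
  · obtain ⟨r, hr0, hr⟩ := Metric.mem_nhds_iff.mp hU
    have hm : 0 < min r δ := lt_min hr0 hδ0
    refine ⟨_, hnhds _ hm, fun w hw k => hr ?_⟩
    have hwδ : W (w - z) < δ ^ 2 / A := hw.trans_le (by gcongr; exact min_le_right _ _)
    have hle : ρ ^ k * W (w - z) ≤ W (w - z) :=
      mul_le_of_le_one_left (hWnn _) (pow_le_one₀ hρ0 hρ1.le)
    exact (hsub _ hm _ (((hiter w hwδ k).trans hle).trans_lt hw)).trans_le (min_le_left _ _)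
  · rw [tendsto_iff_norm_sub_tendsto_zero]
    have h0 : Tendsto (fun k : ℕ => A * (ρ ^ k * W (w - z))) atTop (𝓝 0) := by
      simpa using ((tendsto_pow_atTop_nhds_zero_of_lt_one hρ0 hρ1).mul_const _).const_mul A
    have h1 : Tendsto (fun k : ℕ => ‖F^[k] w - z‖ ^ 2) atTop (𝓝 0) :=
      squeeze_zero (fun _ => by positivity)
        (fun k => (hA _).trans (by have := hiter w hw k; gcongr)) h0
    simpa [Real.sqrt_sq (norm_nonneg _)] using h1.sqrt

/-- Asymptotic stability descends along continuous open semiconjugacies. -/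
theorem IsLocallyAsymptoticallyStable.of_semiconj {Y Z : Type*} [TopologicalSpace Y]
    [TopologicalSpace Z] {F : Y → Y} {G : Z → Z} {Φ : Y → Z} (hc : Continuous Φ)
    (ho : IsOpenMap Φ) (h : Function.Semiconj Φ F G) {y : Y}
    (hy : IsLocallyAsymptoticallyStable F y) : IsLocallyAsymptoticallyStable G (Φ y) := by
  obtain ⟨h1, h2, V, hV, h3⟩ := hy
  refine ⟨by rw [← h.eq, h1], fun U hU => ?_, Φ '' V, ho.image_mem_nhds hV, ?_⟩
  · obtain ⟨V, hV, hk⟩ := h2 _ (hc.continuousAt.preimage_mem_nhds hU)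
    refine ⟨Φ '' V, ho.image_mem_nhds hV, ?_⟩
    rintro _ ⟨v, hv, rfl⟩ k
    rw [← (h.iterate_right k).eq]
    exact hk v hv k
  · rintro _ ⟨v, hv, rfl⟩
    simp_rw [← (h.iterate_right _).eq]
    exact (hc.tendsto y).comp (h3 v hv)

/-! ### Minimum-energy control and a Lyapunov function for the closed loop -/

namespace AgentSystem

variable {N n m : ℕ}

/-- The `k`-th (time-reversed) sample of the minimum-energy control that steers the state of
agent `i` from `x` to the origin. -/
noncomputable def optimalControl (S : AgentSystem N n m) (i : Fin N) (k : ℕ) (x : Fin n → ℝ) :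
    Fin m → ℝ :=
  (S.B i)ᵀ *ᵥ ((S.A i)ᵀ ^ k *ᵥ ((S.gramian i)⁻¹ *ᵥ (S.A i ^ S.horizon *ᵥ x)))

/-- The minimum energy needed to steer the state of agent `i` from `x` to the origin. -/
noncomputable def energy (S : AgentSystem N n m) (i : Fin N) (x : Fin n → ℝ) : ℝ :=
  x ⬝ᵥ (S.costWeight i *ᵥ x)

/-- The samples enter the dynamics with a minus sign and in reversed time, so index `horizon - 1` is
applied first. The sum is the Gramian times its inverse applied to the free response, which it
therefore cancels. -/
theorem sum_optimalControl (S : AgentSystem N n m) (i : Fin N) (hG : IsUnit (S.gramian i))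
    (x : Fin n → ℝ) :
    ∑ k ∈ Finset.range S.horizon, S.A i ^ k *ᵥ (S.B i *ᵥ S.optimalControl i k x) =
      S.A i ^ S.horizon *ᵥ x := by
  have h1 : ∀ k, S.A i ^ k *ᵥ (S.B i *ᵥ S.optimalControl i k x) =
      (S.A i ^ k * S.B i * (S.B i)ᵀ * (S.A i)ᵀ ^ k) *ᵥ
        ((S.gramian i)⁻¹ *ᵥ (S.A i ^ S.horizon *ᵥ x)) := fun k => by
    simp only [optimalControl, Matrix.mulVec_mulVec, Matrix.mul_assoc]
  simp_rw [h1]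
  rw [← Matrix.sum_mulVec, ← gramian, Matrix.mulVec_mulVec,
    Matrix.mul_nonsing_inv _ ((Matrix.isUnit_iff_isUnit_det _).mp hG), Matrix.one_mulVec]

/-- The pairing depends on `w` only through its terminal effect. Hence the optimal control is
orthogonal to the difference of any two controls with equal effect. -/
theorem sum_optimalControl_dotProduct (S : AgentSystem N n m) (i : Fin N) (x : Fin n → ℝ)
    (w : ℕ → Fin m → ℝ) (s : Finset ℕ) :
    ∑ k ∈ s, S.optimalControl i k x ⬝ᵥ w k =
      ((S.gramian i)⁻¹ *ᵥ (S.A i ^ S.horizon *ᵥ x)) ⬝ᵥ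
        ∑ k ∈ s, S.A i ^ k *ᵥ (S.B i *ᵥ w k) := by
  rw [dotProduct_sum]
  refine Finset.sum_congr rfl fun k _ => ?_
  rw [optimalControl, Matrix.mulVec_transpose, ← Matrix.dotProduct_mulVec, ← Matrix.transpose_pow,
    Matrix.mulVec_transpose, ← Matrix.dotProduct_mulVec]

theorem energy_eq_sum (S : AgentSystem N n m) (i : Fin N) (hG : IsUnit (S.gramian i))
    (x : Fin n → ℝ) :
    S.energy i x = ∑ k ∈ Finset.range S.horizon,
      S.optimalControl i k x ⬝ᵥ S.optimalControl i k x := by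
  rw [sum_optimalControl_dotProduct, sum_optimalControl S i hG, energy, costWeight,
    Matrix.mul_assoc, ← Matrix.mulVec_mulVec, Matrix.dotProduct_mulVec, Matrix.vecMul_transpose,
    dotProduct_comm, Matrix.mulVec_mulVec]

theorem energy_nonneg (S : AgentSystem N n m) (i : Fin N) (hG : IsUnit (S.gramian i))
    (x : Fin n → ℝ) : 0 ≤ S.energy i x := by
  rw [energy_eq_sum S i hG]
  exact Finset.sum_nonneg fun _ _ => Finset.sum_nonneg fun _ _ => mul_self_nonneg _

theorem dotProduct_self_nonneg_real {n : ℕ} (x : Fin n → ℝ) : 0 ≤ x ⬝ᵥ x :=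
  Finset.sum_nonneg fun _ _ => mul_self_nonneg _

theorem closedLoop_mulVec (S : AgentSystem N n m) (i : Fin N) (x : Fin n → ℝ) :
    S.closedLoop i *ᵥ x =
      S.A i *ᵥ x - S.B i *ᵥ S.optimalControl i (S.horizon - 1) x := by
  simp only [closedLoop, optimalControl, Matrix.sub_mulVec, Matrix.mulVec_mulVec, Matrix.mul_assoc]

/-- The closed loop applies the first optimal sample. The remaining samples followed by zero steer
the new state to the origin, and Pythagoras compares this control with the optimal one there. -/
theorem energy_closedLoop (S : AgentSystem N n m) (i : Fin N) (hG : IsUnit (S.gramian i)) {t : ℕ}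
    (ht : S.horizon = t + 1) (x : Fin n → ℝ) :
    S.energy i x = S.energy i (S.closedLoop i *ᵥ x) +
      S.optimalControl i t x ⬝ᵥ S.optimalControl i t x +
      (S.optimalControl i 0 (S.closedLoop i *ᵥ x) ⬝ᵥ S.optimalControl i 0 (S.closedLoop i *ᵥ x) +
      ∑ k ∈ Finset.range t,
        (S.optimalControl i k x - S.optimalControl i (k + 1) (S.closedLoop i *ᵥ x)) ⬝ᵥ
          (S.optimalControl i k x - S.optimalControl i (k + 1) (S.closedLoop i *ᵥ x))) := by
  set y := S.closedLoop i *ᵥ x with hy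
  -- In reversed time, appending a final zero input puts `0` at index `0` and shifts the old samples
  -- up by one.
  let w : ℕ → Fin m → ℝ := fun k => Nat.rec 0 (fun k _ => S.optimalControl i k x) k
  have hw0 : w 0 = 0 := rfl
  have hw1 : ∀ k, w (k + 1) = S.optimalControl i k x := fun _ => rfl
  have hw : ∑ k ∈ Finset.range S.horizon, S.A i ^ k *ᵥ (S.B i *ᵥ w k) = S.A i ^ S.horizon *ᵥ y := by
    have h0 := congrArg (S.A i *ᵥ ·) (sum_optimalControl S i hG x)
    rw [ht, Finset.sum_range_succ, Matrix.mulVec_add, Matrix.mulVec_sum] at h0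
    rw [ht, Finset.sum_range_succ', hy, closedLoop_mulVec, ht, Nat.add_sub_cancel,
      Matrix.mulVec_sub, Matrix.mulVec_mulVec x, ← pow_succ, pow_succ', ← Matrix.mulVec_mulVec, ← h0]
    simp only [hw0, hw1, Matrix.mulVec_zero, add_zero, Matrix.mulVec_mulVec, pow_succ', Matrix.mul_assoc,
      add_sub_cancel_right]
  have horth : ∑ k ∈ Finset.range S.horizon,
      S.optimalControl i k y ⬝ᵥ (w k - S.optimalControl i k y) = 0 := by
    simp only [dotProduct_sub, Finset.sum_sub_distrib]
    rw [sum_optimalControl_dotProduct, sum_optimalControl_dotProduct, hw,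
      sum_optimalControl S i hG, sub_self]
  have hexp : ∑ k ∈ Finset.range S.horizon, w k ⬝ᵥ w k = S.energy i y +
      ∑ k ∈ Finset.range S.horizon,
        (w k - S.optimalControl i k y) ⬝ᵥ (w k - S.optimalControl i k y) := by
    rw [energy_eq_sum S i hG, ← Finset.sum_add_distrib, ← add_zero (∑ k ∈ _, (_ + _)),
      ← mul_zero (2 : ℝ), ← horth, Finset.mul_sum, ← Finset.sum_add_distrib]
    refine Finset.sum_congr rfl fun k _ => ?_
    simp only [dotProduct_sub, sub_dotProduct, dotProduct_comm (w k)]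
    ring
  rw [ht, Finset.sum_range_succ', Finset.sum_range_succ'] at hexp
  simp only [hw0, hw1, zero_sub, dotProduct_zero, neg_dotProduct, dotProduct_neg, neg_neg] at hexp
  rw [energy_eq_sum S i hG x, ht, Finset.sum_range_succ]
  linarith

theorem energy_closedLoop_le (S : AgentSystem N n m) (hS : S.Reachable) (i : Fin N)
    (x : Fin n → ℝ) : S.energy i (S.closedLoop i *ᵥ x) ≤ S.energy i x := by
  obtain ⟨t, ht⟩ := Nat.exists_eq_succ_of_ne_zero hS.1.ne'
  rw [energy_closedLoop S i (hS.2.1 i) ht x]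
  have h1 := dotProduct_self_nonneg_real (S.optimalControl i t x)
  have h2 := dotProduct_self_nonneg_real (S.optimalControl i 0 (S.closedLoop i *ᵥ x))
  have h3 := Finset.sum_nonneg fun k (_ : k ∈ Finset.range t) => dotProduct_self_nonneg_real
    (S.optimalControl i k x - S.optimalControl i (k + 1) (S.closedLoop i *ᵥ x))
  linarith

theorem energy_closedLoop_pow_le (S : AgentSystem N n m) (hS : S.Reachable) (i : Fin N)
    (j : ℕ) (x : Fin n → ℝ) : S.energy i (S.closedLoop i ^ j *ᵥ x) ≤ S.energy i x := by
  induction j with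
  | zero => simp
  | succ j ih =>
    rw [pow_succ', ← Matrix.mulVec_mulVec]
    exact (energy_closedLoop_le S hS i _).trans ih

/-- Without energy loss all squares in `energy_closedLoop` vanish: the first sample is zero, and
sample `k` at `x` equals sample `k + 1` at the successor state. Each further step thus forces one
more sample to vanish. -/
theorem optimalControl_eq_zero_of_energy_eq (S : AgentSystem N n m) (hS : S.Reachable)
    (i : Fin N) (j : ℕ) (x : Fin n → ℝ) (h : S.energy i (S.closedLoop i ^ j *ᵥ x) = S.energy i x)
    (k : ℕ) (hk : k < S.horizon) (hkj : S.horizon ≤ k + j) : S.optimalControl i k x = 0 := by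
  induction j generalizing x k with
  | zero => omega
  | succ j ih =>
    obtain ⟨t, ht⟩ := Nat.exists_eq_succ_of_ne_zero hS.1.ne'
    rw [pow_succ, ← Matrix.mulVec_mulVec] at h
    have hle := energy_closedLoop_pow_le S hS i j (S.closedLoop i *ᵥ x)
    have hle' := energy_closedLoop_le S hS i x
    have he := energy_closedLoop S i (hS.2.1 i) ht x
    have h1 := dotProduct_self_nonneg_real (S.optimalControl i t x)
    have h2 := dotProduct_self_nonneg_real (S.optimalControl i 0 (S.closedLoop i *ᵥ x))
    have h3 := fun k (_ : k ∈ Finset.range t) => dotProduct_self_nonneg_real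
      (S.optimalControl i k x - S.optimalControl i (k + 1) (S.closedLoop i *ᵥ x))
    have h3' := Finset.sum_nonneg h3
    rcases Nat.lt_or_ge k t with hkt | hkt
    · have hz := (Finset.sum_eq_zero_iff_of_nonneg h3).mp (by linarith) k
        (Finset.mem_range.mpr hkt)
      rw [dotProduct_self_eq_zero, sub_eq_zero] at hz
      rw [hz]
      exact ih _ (by linarith) (k + 1) (by omega) (by omega)
    · have hkt' : k = t := by omega
      rw [hkt', ← dotProduct_self_eq_zero]
      linarith

theorem eq_zero_of_optimalControl (S : AgentSystem N n m) (i : Fin N) (hG : IsUnit (S.gramian i))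
    (hA : IsUnit (S.A i)) (x : Fin n → ℝ)
    (h : ∀ k < S.horizon, S.optimalControl i k x = 0) : x = 0 := by
  have h1 := sum_optimalControl S i hG x
  rw [Finset.sum_eq_zero fun k hk => by rw [h k (Finset.mem_range.mp hk)]; simp] at h1
  exact Matrix.mulVec_injective_of_isUnit (hA.pow S.horizon) (by simpa using h1.symm)

theorem energy_pos (S : AgentSystem N n m) (i : Fin N) (hG : IsUnit (S.gramian i))
    (hA : IsUnit (S.A i)) {x : Fin n → ℝ} (hx : x ≠ 0) : 0 < S.energy i x := by
  refine lt_of_le_of_ne (energy_nonneg S i hG x) fun h => hx ?_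
  rw [energy_eq_sum S i hG, eq_comm,
    Finset.sum_eq_zero_iff_of_nonneg fun k _ => dotProduct_self_nonneg_real _] at h
  exact eq_zero_of_optimalControl S i hG hA x fun k hk =>
    dotProduct_self_eq_zero.mp (h k (Finset.mem_range.mpr hk))

/-- No loss over a full horizon would make every optimal sample zero, so the free motion alone would
reach the origin, contrary to invertibility of `A`. -/
theorem energy_closedLoop_pow_lt (S : AgentSystem N n m) (hS : S.Reachable) (i : Fin N)
    (hA : IsUnit (S.A i)) {x : Fin n → ℝ} (hx : x ≠ 0) :
    S.energy i (S.closedLoop i ^ S.horizon *ᵥ x) < S.energy i x :=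
  lt_of_le_of_ne (energy_closedLoop_pow_le S hS i _ x) fun h =>
    hx (eq_zero_of_optimalControl S i (hS.2.1 i) hA x fun k hk =>
      optimalControl_eq_zero_of_energy_eq S hS i S.horizon x h k hk (by omega))

theorem energy_smul (S : AgentSystem N n m) (i : Fin N) (t : ℝ) (x : Fin n → ℝ) :
    S.energy i (t • x) = t ^ 2 * S.energy i x := by
  simp only [energy, Matrix.mulVec_smul, dotProduct_smul, smul_dotProduct, smul_eq_mul]
  ring

theorem continuous_energy (S : AgentSystem N n m) (i : Fin N) : Continuous (S.energy i) := by
  unfold energy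
  fun_prop

/-- Young's inequality applied to each component of the optimal control, which is linear in the
state. -/
theorem energy_add_le (S : AgentSystem N n m) (i : Fin N) (hG : IsUnit (S.gramian i)) {θ : ℝ}
    (hθ : 0 < θ) (a u : Fin n → ℝ) :
    S.energy i (a + u) ≤ (1 + θ) * S.energy i a + (1 + 1 / θ) * S.energy i u := by
  simp only [energy_eq_sum S i hG, Finset.mul_sum, ← Finset.sum_add_distrib, dotProduct]
  refine Finset.sum_le_sum fun k _ => Finset.sum_le_sum fun j _ => ?_
  have : S.optimalControl i k (a + u) = S.optimalControl i k a + S.optimalControl i k u := by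
    simp only [optimalControl, Matrix.mulVec_add]
  rw [this, Pi.add_apply]
  generalize S.optimalControl i k a j = p
  generalize S.optimalControl i k u j = q
  have h : (1 + θ) * (p * p) + (1 + 1 / θ) * (q * q) - (p + q) * (p + q) = (θ * p - q) ^ 2 / θ := by
    field_simp
    ring
  have : 0 ≤ (θ * p - q) ^ 2 / θ := by positivity
  linarith

/-- The closed loop of each agent has an input-to-state Lyapunov function. -/
theorem exists_lyapunov (S : AgentSystem N n m) (hS : S.Reachable) (i : Fin N)
    (hA : IsUnit (S.A i)) : ∃ H : (Fin n → ℝ) → ℝ, Continuous H ∧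
      (∀ (t : ℝ) v, H (t • v) = t ^ 2 * H v) ∧ (∀ v, v ≠ 0 → 0 < H v) ∧
      ∃ c > 0, ∃ C > 0, ∀ v u, H (S.closedLoop i *ᵥ v + (1 - S.closedLoop i) *ᵥ u) ≤
        H v - c * (v ⬝ᵥ v) + C * (u ⬝ᵥ u) := by
  have hG := hS.2.1 i
  -- The energy need not drop in one step. Summing it over a horizon turns the strict drop over
  -- `horizon` steps into a one-step drop by telescoping.
  set H : (Fin n → ℝ) → ℝ :=
    fun x => ∑ k ∈ Finset.range S.horizon, S.energy i (S.closedLoop i ^ k *ᵥ x) with hH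
  have hc : Continuous H := by
    have := continuous_energy S i
    fun_prop
  have hh : ∀ (t : ℝ) v, H (t • v) = t ^ 2 * H v := fun t v => by
    simp only [hH, Matrix.mulVec_smul, energy_smul, Finset.mul_sum]
  have hp : ∀ v, v ≠ 0 → 0 < H v := fun v hv =>
    Finset.sum_pos' (fun k _ => energy_nonneg S i hG _)
      ⟨0, Finset.mem_range.mpr hS.1, by simpa using energy_pos S i hG hA hv⟩
  have hdec : ∀ v, v ≠ 0 → H (S.closedLoop i *ᵥ v) < H v := fun v hv => by
    have h1 := Finset.sum_range_succ (fun k => S.energy i (S.closedLoop i ^ k *ᵥ v)) S.horizon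
    rw [Finset.sum_range_succ'] at h1
    have h2 := energy_closedLoop_pow_lt S hS i hA hv
    simp only [hH, Matrix.mulVec_mulVec, ← pow_succ]
    simp only [pow_zero, Matrix.one_mulVec] at h1
    linarith
  have hadd : ∀ θ : ℝ, 0 < θ → ∀ a u, H (a + u) ≤ (1 + θ) * H a + (1 + 1 / θ) * H u := by
    intro θ hθ a u
    simp only [hH, Finset.mul_sum, ← Finset.sum_add_distrib, Matrix.mulVec_add]
    exact Finset.sum_le_sum fun k _ => energy_add_le S i hG hθ _ _
  have hdc : Continuous fun v : Fin n → ℝ => v ⬝ᵥ v := by fun_prop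
  have hdh : ∀ (t : ℝ) (v : Fin n → ℝ), (t • v) ⬝ᵥ (t • v) = t ^ 2 * (v ⬝ᵥ v) := fun t v => by
    simp only [dotProduct_smul, smul_dotProduct, smul_eq_mul]; ring
  have hdp : ∀ v : Fin n → ℝ, v ≠ 0 → 0 < v ⬝ᵥ v := fun v hv =>
    lt_of_le_of_ne (dotProduct_self_nonneg_real v) fun h => hv (dotProduct_self_eq_zero.mp h.symm)
  obtain ⟨C₁, hC₁, h₁⟩ := exists_le_mul_of_homogeneous hdc
    (g := fun v => H v - H (S.closedLoop i *ᵥ v)) (by fun_prop) hdh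
    (fun t v => by simp only [Matrix.mulVec_smul, hh]; ring) fun v hv => sub_pos.mpr (hdec v hv)
  obtain ⟨C₂, hC₂, h₂⟩ := exists_le_mul_of_homogeneous hc hdc hh hdh hdp
  obtain ⟨C₃, hC₃, h₃⟩ := exists_le_mul_of_homogeneous
    (f := fun u => H ((1 - S.closedLoop i) *ᵥ u)) (by fun_prop) hdc
    (fun t v => by simp only [Matrix.mulVec_smul, hh]) hdh hdp
  have hC₁0 : 0 < C₁ := by linarith
  have hC₂0 : 0 < C₂ := by linarith
  have hC₃0 : 0 < C₃ := by linarith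
  -- With this weight the Young term `θ H` costs at most half of the decrease `(1 / C₁) |v|²`.
  set θ : ℝ := 1 / (2 * C₁ * C₂) with hθ
  have hθ0 : 0 < θ := by positivity
  refine ⟨H, hc, hh, hp, 1 / (2 * C₁), by positivity, (1 + 1 / θ) * C₃, by positivity,
    fun v u => (hadd θ hθ0 _ _).trans ?_⟩
  have e1 : (1 / C₁) * (v ⬝ᵥ v) ≤ H v - H (S.closedLoop i *ᵥ v) := by
    rw [one_div, inv_mul_le_iff₀ hC₁0]; exact h₁ v
  have e2 : θ * H (S.closedLoop i *ᵥ v) ≤ 1 / (2 * C₁) * (v ⬝ᵥ v) := by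
    have : H (S.closedLoop i *ᵥ v) ≤ C₂ * (v ⬝ᵥ v) := by
      have := h₂ v
      have : 0 ≤ (1 / C₁) * (v ⬝ᵥ v) := mul_nonneg (by positivity) (dotProduct_self_nonneg_real v)
      linarith
    calc _ ≤ θ * (C₂ * (v ⬝ᵥ v)) := by gcongr
      _ = _ := by rw [hθ]; field_simp
  have e3 : (1 + 1 / θ) * H ((1 - S.closedLoop i) *ᵥ u) ≤ (1 + 1 / θ) * C₃ * (u ⬝ᵥ u) := by
    rw [mul_assoc]
    gcongr
    exact h₃ u
  have e4 : (1 / C₁) * (v ⬝ᵥ v) = 1 / (2 * C₁) * (v ⬝ᵥ v) + 1 / (2 * C₁) * (v ⬝ᵥ v) := by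
    field_simp; ring
  linarith

/-- One is not an eigenvalue of the closed loop. -/
theorem eq_zero_of_one_sub_closedLoop_mulVec (S : AgentSystem N n m) (hS : S.Reachable)
    (i : Fin N) (hA : IsUnit (S.A i)) {v : Fin n → ℝ} (hv : (1 - S.closedLoop i) *ᵥ v = 0) :
    v = 0 := by
  by_contra hne
  have h1 : S.closedLoop i *ᵥ v = v := by
    rw [Matrix.sub_mulVec, Matrix.one_mulVec, sub_eq_zero] at hv
    exact hv.symm
  have h2 : ∀ k, S.closedLoop i ^ k *ᵥ v = v := fun k => by
    induction k with
    | zero => simp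
    | succ k ih => rw [pow_succ, ← Matrix.mulVec_mulVec, h1, ih]
  have h3 := energy_closedLoop_pow_lt S hS i hA hne
  rw [h2] at h3
  exact h3.false

end AgentSystem

/-! ### Logarithmic coordinates on the projective cone -/

namespace Sinkhorn

variable {N : ℕ}

/-- The class of the positive vector with logarithm `b`. -/
noncomputable def expClass (b : Fin N → ℝ) : ProjCone N :=
  Quotient.mk (posVecSetoid N) ⟨fun j => Real.exp (b j), fun _ => Real.exp_pos _⟩

theorem expClass_eq_iff {b c : Fin N → ℝ} :
    expClass b = expClass c ↔ ∃ r : ℝ, ∀ j, b j = c j + r := by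
  rw [expClass, expClass, Quotient.eq]
  constructor
  · rintro ⟨r, hr, h⟩
    refine ⟨Real.log r, fun j => ?_⟩
    have := congrFun h j
    simp only [Pi.smul_apply, smul_eq_mul] at this
    rw [← Real.log_exp (b j), this, Real.log_mul hr.ne' (Real.exp_pos _).ne', Real.log_exp,
      add_comm]
  · rintro ⟨r, h⟩
    refine ⟨Real.exp r, Real.exp_pos _, ?_⟩
    funext j
    simp only [Pi.smul_apply, smul_eq_mul]
    rw [h, Real.exp_add, mul_comm]

theorem continuous_expClass : Continuous (expClass (N := N)) :=
  continuous_quotient_mk'.comp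
    (Continuous.subtype_mk (by fun_prop : Continuous fun (b : Fin N → ℝ) j => Real.exp (b j)) _)

theorem expClass_log (β : PosVec N) :
    expClass (fun j => Real.log (β.1 j)) = Quotient.mk (posVecSetoid N) β := by
  rw [expClass]
  congr
  funext j
  exact Real.exp_log (β.2 j)

/-- The saturation of an open set is the union of its translates along the constants, which is open.
-/
theorem isOpenMap_expClass : IsOpenMap (expClass (N := N)) := by
  intro U hU
  change IsOpen ((Quotient.mk (posVecSetoid N)) ⁻¹' _)
  have : (Quotient.mk (posVecSetoid N)) ⁻¹' (expClass '' U) =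
      ⋃ r : ℝ, (fun β : PosVec N => fun j => Real.log (β.1 j) + r) ⁻¹' U := by
    ext β
    simp only [Set.mem_preimage, Set.mem_image, Set.mem_iUnion]
    constructor
    · rintro ⟨b, hb, h⟩
      rw [← expClass_log, expClass_eq_iff] at h
      obtain ⟨r, h⟩ := h
      exact ⟨r, by rwa [← show b = _ from funext h]⟩
    · rintro ⟨r, h⟩
      refine ⟨_, h, ?_⟩
      rw [← expClass_log, expClass_eq_iff]
      exact ⟨r, fun _ => rfl⟩
  rw [this]
  refine isOpen_iUnion fun r => hU.preimage ?_
  refine continuous_pi fun j => Continuous.add ?_ continuous_const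
  exact Continuous.log ((continuous_apply j).comp continuous_subtype_val) fun β => (β.2 j).ne'

/-- Subtraction of the mean value. -/
noncomputable def center (b : Fin N → ℝ) : Fin N → ℝ := fun j => b j - (∑ k, b k) / N

theorem sum_center (b : Fin N → ℝ) : ∑ j, center b j = 0 := by
  rcases Nat.eq_zero_or_pos N with rfl | hN
  · simp
  · have : (N : ℝ) ≠ 0 := by positivity
    simp only [center, Finset.sum_sub_distrib, Finset.sum_const, Finset.card_univ, Fintype.card_fin,
      nsmul_eq_mul]
    field_simp
    ring

theorem center_of_sum_eq_zero {b : Fin N → ℝ} (hb : ∑ j, b j = 0) : center b = b := by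
  funext j
  simp [center, hb]

theorem expClass_center (b : Fin N → ℝ) : expClass (center b) = expClass b :=
  expClass_eq_iff.mpr ⟨-((∑ k, b k) / N), fun _ => rfl⟩

/-- Centring is the orthogonal projection onto the vectors of sum zero. -/
theorem sum_center_sq_le (b : Fin N → ℝ) : ∑ j, center b j ^ 2 ≤ ∑ j, b j ^ 2 := by
  set c := (∑ k, b k) / N with hc
  have h1 : ∑ j, b j ^ 2 = ∑ j, center b j ^ 2 + 2 * c * ∑ j, center b j + ∑ _j : Fin N, c ^ 2 := by
    rw [Finset.mul_sum, ← Finset.sum_add_distrib, ← Finset.sum_add_distrib]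
    refine Finset.sum_congr rfl fun j _ => ?_
    simp only [center]
    ring
  rw [h1, sum_center]
  have : 0 ≤ ∑ _j : Fin N, c ^ 2 := Finset.sum_nonneg fun _ _ => sq_nonneg c
  linarith

/-- The row-wise softmax of `bⱼ - Cᵢⱼ / ε`. -/
noncomputable def softPlan (C : Matrix (Fin N) (Fin N) ℝ) (ε : ℝ) (b : Fin N → ℝ) (i j : Fin N) :
    ℝ :=
  Real.exp (b j - C i j / ε) / ∑ k, Real.exp (b k - C i k / ε)

theorem sum_exp_pos (i : Fin N) (a : Fin N → ℝ) : 0 < ∑ k, Real.exp (a k) :=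
  Finset.sum_pos (fun _ _ => Real.exp_pos _) ⟨i, Finset.mem_univ i⟩

theorem softPlan_pos (C : Matrix (Fin N) (Fin N) ℝ) (ε : ℝ) (b : Fin N → ℝ) (i j : Fin N) :
    0 < softPlan C ε b i j :=
  div_pos (Real.exp_pos _) (sum_exp_pos i _)

theorem sum_softPlan (C : Matrix (Fin N) (Fin N) ℝ) (ε : ℝ) (b : Fin N → ℝ) (i : Fin N) :
    ∑ j, softPlan C ε b i j = 1 := by
  simp only [softPlan]
  rw [← Finset.sum_div, div_self (sum_exp_pos i _).ne']

theorem sum_col_softPlan_pos (C : Matrix (Fin N) (Fin N) ℝ) (ε : ℝ) (b : Fin N → ℝ) (j : Fin N) :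
    0 < ∑ i, softPlan C ε b i j :=
  Finset.sum_pos (fun i _ => softPlan_pos C ε b i j) ⟨j, Finset.mem_univ j⟩

/-- One Sinkhorn iteration in logarithmic coordinates. -/
noncomputable def logUpdate (C : Matrix (Fin N) (Fin N) ℝ) (ε : ℝ) (b : Fin N → ℝ) : Fin N → ℝ :=
  fun j => b j - Real.log (∑ i, softPlan C ε b i j)

end Sinkhorn

/-! ### The joint dynamics in logarithmic coordinates and their equilibria -/

namespace AgentSystem

open Sinkhorn

variable {N n m : ℕ}

theorem gibbs_mul_exp (S : AgentSystem N n m) (ε : ℝ) (x : Fin N → Fin n → ℝ) (b : Fin N → ℝ)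
    (i j : Fin N) : S.gibbs ε x i j * Real.exp (b j) =
      Real.exp (b j - S.costMatrix x i j / ε) := by
  rw [gibbs, Matrix.of_apply, ← Real.exp_add]
  congr 1
  ring

theorem rowScaling_gibbs (S : AgentSystem N n m) (ε : ℝ) (x : Fin N → Fin n → ℝ) (b : Fin N → ℝ)
    (i : Fin N) : rowScaling (S.gibbs ε x) (fun j => Real.exp (b j)) i =
      (1 / (N : ℝ)) / ∑ k, Real.exp (b k - S.costMatrix x i k / ε) := by
  simp only [rowScaling, Matrix.mulVec, dotProduct, gibbs_mul_exp]

theorem planProj_expClass (S : AgentSystem N n m) (ε : ℝ) (x : Fin N → Fin n → ℝ)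
    (b : Fin N → ℝ) (i j : Fin N) : planProj (S.gibbs ε x) (expClass b) i j =
      1 / (N : ℝ) * softPlan (S.costMatrix x) ε b i j := by
  change plan (S.gibbs ε x) (fun j => Real.exp (b j)) i j = _
  rw [plan, Matrix.mul_diagonal, Matrix.diagonal_mul, mul_assoc, gibbs_mul_exp, rowScaling_gibbs,
    softPlan]
  ring

theorem updateProj_expClass (S : AgentSystem N n m) (ε : ℝ) (x : Fin N → Fin n → ℝ)
    (b : Fin N → ℝ) : updateProj (S.gibbs ε x) (S.gibbs_pos ε x) (expClass b) =
      expClass (logUpdate (S.costMatrix x) ε b) := by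
  refine congrArg (Quotient.mk (posVecSetoid N)) (Subtype.ext (funext fun j => ?_))
  change update (S.gibbs ε x) (fun j => Real.exp (b j)) j =
    Real.exp (logUpdate (S.costMatrix x) ε b j)
  have hN : (N : ℝ) ≠ 0 := (Nat.cast_pos.mpr (Fin.pos j)).ne'
  have hpos := sum_col_softPlan_pos (S.costMatrix x) ε b j
  have hsum : ∑ i, S.gibbs ε x i j * rowScaling (S.gibbs ε x) (fun j => Real.exp (b j)) i =
      1 / (N : ℝ) * (∑ i, softPlan (S.costMatrix x) ε b i j) / Real.exp (b j) := by
    rw [Finset.mul_sum, Finset.sum_div]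
    refine Finset.sum_congr rfl fun i _ => ?_
    rw [eq_div_iff (Real.exp_pos _).ne', rowScaling_gibbs, softPlan, ← gibbs_mul_exp]
    ring
  rw [update]
  simp only [Matrix.mulVec, dotProduct, Matrix.transpose_apply, logUpdate]
  rw [hsum, Real.exp_sub, Real.exp_log hpos]
  have := Real.exp_pos (b j)
  field_simp

/-- The joint dynamics in coordinates, the vectors `β` being represented by their logarithms,
normalized to mean zero. -/
noncomputable def logDynamics (S : AgentSystem N n m) (ε : ℝ)
    (z : (Fin N → Fin n → ℝ) × (Fin N → ℝ)) : (Fin N → Fin n → ℝ) × (Fin N → ℝ) :=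
  let y : Fin N → Fin n → ℝ := fun i => S.closedLoop i *ᵥ z.1 i +
    (1 - S.closedLoop i) *ᵥ ∑ j, softPlan (S.costMatrix z.1) ε z.2 i j • S.target j
  (y, center (logUpdate (S.costMatrix y) ε z.2))

theorem nextState_expClass (S : AgentSystem N n m) (ε : ℝ) (x : Fin N → Fin n → ℝ)
    (b : Fin N → ℝ) : S.nextState ε x (expClass b) = (S.logDynamics ε (x, b)).1 := by
  funext i
  have hN : (N : ℝ) ≠ 0 := (Nat.cast_pos.mpr (Fin.pos i)).ne'
  simp only [nextState, logDynamics, tempTarget, planProj_expClass, mul_smul, Finset.smul_sum]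
  congr 3
  funext j
  rw [smul_smul, mul_one_div_cancel hN, one_smul]

theorem semiconj_logDynamics (S : AgentSystem N n m) (ε : ℝ) :
    Function.Semiconj (Prod.map id expClass) (S.logDynamics ε) (S.dynamics ε) := by
  rintro ⟨x, b⟩
  simp only [dynamics, Prod.map_apply, id, nextState_expClass, updateProj_expClass]
  refine Prod.ext rfl ?_
  exact expClass_center _

/-- The structure of the equilibria, in coordinates. -/
theorem exists_logDynamics_eq (S : AgentSystem N n m) (hS : S.Reachable)
    (hA : ∀ i, IsUnit (S.A i)) {ε : ℝ} {z : (Fin N → Fin n → ℝ) × ProjCone N}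
    (hz : S.dynamics ε z = z) : ∃ b : Fin N → ℝ, z = (z.1, expClass b) ∧
      S.logDynamics ε (z.1, b) = (z.1, b) ∧
      (∀ j, ∑ i, softPlan (S.costMatrix z.1) ε b i j = 1) ∧
      ∀ i, z.1 i = ∑ j, softPlan (S.costMatrix z.1) ε b i j • S.target j := by
  obtain ⟨x, β⟩ := z
  obtain ⟨β, rfl⟩ := Quotient.exists_rep β
  set b := center fun j => Real.log (β.1 j) with hb
  have hbβ : Quotient.mk (posVecSetoid N) β = expClass b := by
    rw [hb, expClass_center, expClass_log]
  have hconj := (S.semiconj_logDynamics ε).eq (x, b)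
  change ((S.logDynamics ε (x, b)).1, expClass (S.logDynamics ε (x, b)).2) =
    S.dynamics ε (x, expClass b) at hconj
  rw [hbβ] at hz
  rw [hz] at hconj
  have h1 : (S.logDynamics ε (x, b)).1 = x := congrArg Prod.fst hconj
  have h2 : expClass (S.logDynamics ε (x, b)).2 = expClass b := congrArg Prod.snd hconj
  have h2' : (S.logDynamics ε (x, b)).2 = center (logUpdate (S.costMatrix x) ε b) := by
    conv_rhs => rw [← h1]
    rfl
  rw [h2', expClass_center, expClass_eq_iff] at h2
  obtain ⟨r, hr⟩ := h2
  -- A projective fixed point determines the column sums only up to a common factor. Counting the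
  -- total mass `N` by rows shows that the factor is one.
  have hconst : ∀ j, ∑ i, softPlan (S.costMatrix x) ε b i j = Real.exp (-r) := fun j => by
    have := hr j
    simp only [logUpdate] at this
    rw [← Real.exp_log (sum_col_softPlan_pos (S.costMatrix x) ε b j)]
    congr 1
    linarith
  have hcol : ∀ j, ∑ i, softPlan (S.costMatrix x) ε b i j = 1 := fun j => by
    have hN : (N : ℝ) ≠ 0 := (Nat.cast_pos.mpr (Fin.pos j)).ne'
    have htot : ∑ i, ∑ j, softPlan (S.costMatrix x) ε b i j =
        ∑ j, ∑ i, softPlan (S.costMatrix x) ε b i j := Finset.sum_comm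
    simp only [sum_softPlan, hconst, Finset.sum_const, Finset.card_univ, Fintype.card_fin,
      nsmul_eq_mul] at htot
    rw [hconst j]
    exact (mul_left_cancel₀ hN htot).symm
  have hupd : logUpdate (S.costMatrix x) ε b = b := by
    funext j
    simp [logUpdate, hcol]
  refine ⟨b, by rw [hbβ], ?_, hcol, fun i => ?_⟩
  · refine Prod.ext h1 ?_
    rw [h2', hupd]
    exact center_of_sum_eq_zero (sum_center _)
  · have hi := congrFun h1 i
    simp only [logDynamics] at hi
    refine sub_eq_zero.mp (S.eq_zero_of_one_sub_closedLoop_mulVec hS i (hA i) ?_)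
    rw [Matrix.mulVec_sub, sub_eq_zero, Matrix.sub_mulVec, Matrix.one_mulVec, sub_eq_iff_eq_add']
    exact hi.symm

theorem transpose_gramian (S : AgentSystem N n m) (i : Fin N) : (S.gramian i)ᵀ = S.gramian i := by
  simp only [gramian, Matrix.transpose_sum, Matrix.transpose_mul, Matrix.transpose_pow,
    Matrix.transpose_transpose, Matrix.mul_assoc]

theorem transpose_costWeight (S : AgentSystem N n m) (i : Fin N) :
    (S.costWeight i)ᵀ = S.costWeight i := by
  simp only [costWeight, Matrix.transpose_mul, Matrix.transpose_transpose,
    Matrix.transpose_nonsing_inv, transpose_gramian, Matrix.mul_assoc]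

/-! ### The linearization at an equilibrium -/

/-- The derivative of `bⱼ - Cᵢⱼ(x) / ε` in the direction `(ξ, β)`. -/
noncomputable def logitDeriv (S : AgentSystem N n m) (ε : ℝ) (x ξ : Fin N → Fin n → ℝ)
    (β : Fin N → ℝ) (i j : Fin N) : ℝ :=
  β j - 2 / ε * ((x i - S.target j) ⬝ᵥ (S.costWeight i *ᵥ ξ i))

/-- The derivative of the softmax plan in the direction `(ξ, β)`. -/
noncomputable def planDeriv (S : AgentSystem N n m) (ε : ℝ) (x : Fin N → Fin n → ℝ)
    (b : Fin N → ℝ) (ξ : Fin N → Fin n → ℝ) (β : Fin N → ℝ) (i j : Fin N) : ℝ :=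
  softPlan (S.costMatrix x) ε b i j * (S.logitDeriv ε x ξ β i j -
    ∑ k, softPlan (S.costMatrix x) ε b i k * S.logitDeriv ε x ξ β i k)

theorem hasDerivAt_logit (S : AgentSystem N n m) (ε : ℝ) {x : ℝ → Fin N → Fin n → ℝ}
    {b : ℝ → Fin N → ℝ} {ξ : Fin N → Fin n → ℝ} {β : Fin N → ℝ} {t : ℝ} (hx : HasDerivAt x ξ t)
    (hb : HasDerivAt b β t) (i j : Fin N) :
    HasDerivAt (fun s => b s j - S.costMatrix (x s) i j / ε) (S.logitDeriv ε (x t) ξ β i j) t := by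
  have hbj := (hasDerivAt_pi.mp hb) j
  have hxi : ∀ l, HasDerivAt (fun s => x s i l) (ξ i l) t :=
    fun l => hasDerivAt_pi.mp (hasDerivAt_pi.mp hx i) l
  have hC : HasDerivAt (fun s => S.costMatrix (x s) i j)
      (ξ i ⬝ᵥ (S.costWeight i *ᵥ (x t i - S.target j)) +
        (x t i - S.target j) ⬝ᵥ (S.costWeight i *ᵥ ξ i)) t := by
    simp only [costMatrix, Matrix.of_apply, dotProduct, Matrix.mulVec, Pi.sub_apply]
    rw [← Finset.sum_add_distrib]
    refine HasDerivAt.fun_sum fun l _ => ?_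
    refine HasDerivAt.mul ((hxi l).sub_const _) (HasDerivAt.fun_sum fun k _ => ?_)
    exact ((hxi k).sub_const _).const_mul _
  have hsymm : ξ i ⬝ᵥ (S.costWeight i *ᵥ (x t i - S.target j)) =
      (x t i - S.target j) ⬝ᵥ (S.costWeight i *ᵥ ξ i) := by
    rw [Matrix.dotProduct_mulVec, ← Matrix.mulVec_transpose, transpose_costWeight, dotProduct_comm]
  refine (hbj.sub (hC.div_const ε)).congr_deriv ?_
  rw [hsymm, logitDeriv]
  ring

theorem hasDerivAt_softPlan (S : AgentSystem N n m) (ε : ℝ) {x : ℝ → Fin N → Fin n → ℝ}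
    {b : ℝ → Fin N → ℝ} {ξ : Fin N → Fin n → ℝ} {β : Fin N → ℝ} {t : ℝ} (hx : HasDerivAt x ξ t)
    (hb : HasDerivAt b β t) (i j : Fin N) :
    HasDerivAt (fun s => softPlan (S.costMatrix (x s)) ε (b s) i j)
      (S.planDeriv ε (x t) (b t) ξ β i j) t := by
  have hl := fun k => (S.hasDerivAt_logit ε hx hb i k).exp
  have hs := HasDerivAt.fun_sum fun k (_ : k ∈ Finset.univ) => hl k
  have hpos := sum_exp_pos i fun k => b t k - S.costMatrix (x t) i k / ε
  refine ((hl j).div hs hpos.ne').congr_deriv ?_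
  rw [planDeriv]
  simp only [softPlan, div_mul_eq_mul_div]
  rw [← Finset.sum_div]
  field_simp

/-- The next states of the linearization of the joint dynamics. -/
noncomputable def linState (S : AgentSystem N n m) (ε : ℝ) (x : Fin N → Fin n → ℝ)
    (b : Fin N → ℝ) (v : (Fin N → Fin n → ℝ) × (Fin N → ℝ)) : Fin N → Fin n → ℝ :=
  fun i => S.closedLoop i *ᵥ v.1 i +
    (1 - S.closedLoop i) *ᵥ ∑ j, S.planDeriv ε x b v.1 v.2 i j • S.target j

/-- The linearization of the joint dynamics at an equilibrium. -/
noncomputable def linDynamics (S : AgentSystem N n m) (ε : ℝ) (x : Fin N → Fin n → ℝ)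
    (b : Fin N → ℝ) (v : (Fin N → Fin n → ℝ) × (Fin N → ℝ)) : (Fin N → Fin n → ℝ) × (Fin N → ℝ) :=
  (S.linState ε x b v,
    center fun j => v.2 j - ∑ i, S.planDeriv ε x b (S.linState ε x b v) v.2 i j)

theorem hasDerivAt_mulVec {k l : ℕ} (M : Matrix (Fin k) (Fin l) ℝ) {f : ℝ → Fin l → ℝ}
    {f' : Fin l → ℝ} {t : ℝ} (hf : HasDerivAt f f' t) :
    HasDerivAt (fun s => M *ᵥ f s) (M *ᵥ f') t := by
  refine hasDerivAt_pi.mpr fun i => ?_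
  simp only [Matrix.mulVec, dotProduct]
  exact HasDerivAt.fun_sum fun j _ => (hasDerivAt_pi.mp hf j).const_mul _

theorem hasLineDerivAt_logDynamics (S : AgentSystem N n m) (ε : ℝ) {x : Fin N → Fin n → ℝ}
    {b : Fin N → ℝ} (hfix : S.logDynamics ε (x, b) = (x, b))
    (hcol : ∀ j, ∑ i, softPlan (S.costMatrix x) ε b i j = 1)
    (v : (Fin N → Fin n → ℝ) × (Fin N → ℝ)) :
    HasLineDerivAt ℝ (S.logDynamics ε) (S.linDynamics ε x b v) (x, b) v := by
  have hx : HasDerivAt (fun t : ℝ => x + t • v.1) v.1 0 := by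
    simpa using ((hasDerivAt_id (0 : ℝ)).smul_const v.1).const_add x
  have hb : HasDerivAt (fun t : ℝ => b + t • v.2) v.2 0 := by
    simpa using ((hasDerivAt_id (0 : ℝ)).smul_const v.2).const_add b
  have hx0 : x + (0 : ℝ) • v.1 = x := by simp
  have hb0 : b + (0 : ℝ) • v.2 = b := by simp
  have hy : HasDerivAt (fun t : ℝ => (S.logDynamics ε ((x, b) + t • v)).1)
      (S.linState ε x b v) 0 := by
    refine hasDerivAt_pi.mpr fun i => ?_
    refine (hasDerivAt_mulVec _ (hasDerivAt_pi.mp hx i)).add (hasDerivAt_mulVec _ ?_)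
    refine HasDerivAt.fun_sum fun j _ => HasDerivAt.smul_const ?_ _
    have := S.hasDerivAt_softPlan ε hx hb i j
    rwa [hx0, hb0] at this
  have hy0 : (S.logDynamics ε ((x, b) + (0 : ℝ) • v)).1 = x := by
    rw [zero_smul, add_zero, hfix]
  have hu : HasDerivAt (fun t : ℝ => logUpdate
      (S.costMatrix (S.logDynamics ε ((x, b) + t • v)).1) ε (b + t • v.2))
      (fun j => v.2 j - ∑ i, S.planDeriv ε x b (S.linState ε x b v) v.2 i j) 0 := by
    refine hasDerivAt_pi.mpr fun j => (hasDerivAt_pi.mp hb j).sub ?_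
    have h1 : HasDerivAt (fun t : ℝ => ∑ i, softPlan
        (S.costMatrix (S.logDynamics ε ((x, b) + t • v)).1) ε (b + t • v.2) i j)
        (∑ i, S.planDeriv ε x b (S.linState ε x b v) v.2 i j) 0 := by
      refine HasDerivAt.fun_sum fun i _ => ?_
      have := S.hasDerivAt_softPlan ε hy hb i j
      rwa [hy0, hb0] at this
    have h2 : ∑ i, softPlan (S.costMatrix (S.logDynamics ε ((x, b) + (0 : ℝ) • v)).1) ε
        (b + (0 : ℝ) • v.2) i j = 1 := by
      rw [hy0, hb0, hcol]
    -- The column sums equal one at the equilibrium, so the logarithm contributes the factor one.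
    have h3 := h1.log (by rw [h2]; exact one_ne_zero)
    rwa [h2, div_one] at h3
  refine hy.prodMk ?_
  refine hasDerivAt_pi.mpr fun j => (hasDerivAt_pi.mp hu j).sub (HasDerivAt.div_const ?_ _)
  exact HasDerivAt.fun_sum fun k _ => hasDerivAt_pi.mp hu k

theorem differentiable_softPlan (S : AgentSystem N n m) (ε : ℝ) (i j : Fin N) :
    Differentiable ℝ fun z : (Fin N → Fin n → ℝ) × (Fin N → ℝ) =>
      softPlan (S.costMatrix z.1) ε z.2 i j := by
  have hC : ∀ k, Differentiable ℝ fun z : (Fin N → Fin n → ℝ) × (Fin N → ℝ) =>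
      z.2 k - S.costMatrix z.1 i k / ε := fun k => by
    simp only [costMatrix, Matrix.of_apply, dotProduct, Matrix.mulVec, Pi.sub_apply]
    fun_prop
  simp only [softPlan]
  have hs : Differentiable ℝ fun z : (Fin N → Fin n → ℝ) × (Fin N → ℝ) =>
      ∑ k, Real.exp (z.2 k - S.costMatrix z.1 i k / ε) :=
    Differentiable.fun_sum fun k _ => (hC k).exp
  simp only [div_eq_mul_inv (Real.exp _)]
  exact (hC j).exp.mul (hs.inv fun z => (sum_exp_pos i _).ne')

/-- This provides a Fréchet derivative, whose values are then identified by the line derivatives. -/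
theorem differentiable_logDynamics (S : AgentSystem N n m) (ε : ℝ) :
    Differentiable ℝ (S.logDynamics ε) := by
  have hy : Differentiable ℝ fun z => (S.logDynamics ε z).1 := by
    refine differentiable_pi.mpr fun i => differentiable_pi.mpr fun l => ?_
    have := fun j => S.differentiable_softPlan ε i j
    simp only [logDynamics, Matrix.mulVec, dotProduct, Pi.add_apply, Finset.sum_apply,
      Pi.smul_apply]
    fun_prop
  have hu : ∀ j, Differentiable ℝ fun z : (Fin N → Fin n → ℝ) × (Fin N → ℝ) =>
      logUpdate (S.costMatrix (S.logDynamics ε z).1) ε z.2 j := fun j => by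
    refine Differentiable.sub (by fun_prop) (Differentiable.log ?_ fun z =>
      (sum_col_softPlan_pos _ ε _ j).ne')
    refine Differentiable.fun_sum fun i _ => ?_
    exact (S.differentiable_softPlan ε i j).comp (hy.prodMk differentiable_snd)
  have hs : Differentiable ℝ fun z : (Fin N → Fin n → ℝ) × (Fin N → ℝ) =>
      ∑ k, logUpdate (S.costMatrix (S.logDynamics ε z).1) ε z.2 k :=
    Differentiable.fun_sum fun k _ => hu k
  refine hy.prodMk (differentiable_pi.mpr fun j => (hu j).sub ?_)
  simp only [div_eq_mul_inv]
  exact hs.mul_const _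

end AgentSystem

/-! ### Averaging with doubly stochastic matrices -/

namespace Sinkhorn

variable {N : ℕ}

/-- The total variance of `β` under the rows of a stochastic matrix. -/
noncomputable def rowVariance (Q : Fin N → Fin N → ℝ) (β : Fin N → ℝ) : ℝ :=
  ∑ i, ∑ j, Q i j * (β j - ∑ k, Q i k * β k) ^ 2

theorem rowVariance_nonneg {Q : Fin N → Fin N → ℝ} (hQ : ∀ i j, 0 ≤ Q i j) (β : Fin N → ℝ) :
    0 ≤ rowVariance Q β :=
  Finset.sum_nonneg fun i _ => Finset.sum_nonneg fun j _ => mul_nonneg (hQ i j) (sq_nonneg _)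

/-- The variance is exactly the squared norm lost in passing from `β` to `Qβ`: unit column sums
recover `∑ βⱼ²` from the second moments of the rows. -/
theorem rowVariance_eq {Q : Fin N → Fin N → ℝ} (hrow : ∀ i, ∑ j, Q i j = 1)
    (hcol : ∀ j, ∑ i, Q i j = 1) (β : Fin N → ℝ) :
    rowVariance Q β = ∑ j, β j ^ 2 - ∑ i, (∑ k, Q i k * β k) ^ 2 := by
  have h1 : ∑ j, β j ^ 2 = ∑ i, ∑ j, Q i j * β j ^ 2 := by
    rw [Finset.sum_comm]
    exact Finset.sum_congr rfl fun j _ => by rw [← Finset.sum_mul, hcol, one_mul]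
  rw [h1, rowVariance, ← Finset.sum_sub_distrib]
  refine Finset.sum_congr rfl fun i _ => ?_
  set μ := ∑ k, Q i k * β k with hμ
  have h2 : ∑ j, Q i j * (β j - μ) ^ 2 =
      ∑ j, Q i j * β j ^ 2 - 2 * μ * ∑ j, Q i j * β j + μ ^ 2 * ∑ j, Q i j := by
    simp only [Finset.mul_sum]
    rw [← Finset.sum_sub_distrib, ← Finset.sum_add_distrib]
    exact Finset.sum_congr rfl fun j _ => by ring
  rw [h2, hrow, ← hμ]
  ring

/-- Perturbed backward-forward averaging with a doubly stochastic matrix contracts the Euclidean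
norm up to the size of the perturbation. -/
theorem sum_sq_average_le {Q : Fin N → Fin N → ℝ} (hQ : ∀ i j, 0 ≤ Q i j)
    (hrow : ∀ i, ∑ j, Q i j = 1) (hcol : ∀ j, ∑ i, Q i j = 1) (β : Fin N → ℝ)
    {φ : Fin N → Fin N → ℝ} (hφ : ∀ i, ∑ j, Q i j * φ i j = 0) :
    ∑ j, (β j - ∑ i, Q i j * (β j - ∑ k, Q i k * β k - φ i j)) ^ 2 ≤
      ∑ j, β j ^ 2 - rowVariance Q β + ∑ i, ∑ j, Q i j * φ i j ^ 2 := by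
  set μ : Fin N → ℝ := fun i => ∑ k, Q i k * β k with hμ
  have h1 : ∀ j, β j - ∑ i, Q i j * (β j - μ i - φ i j) = ∑ i, Q i j * (μ i + φ i j) := fun j => by
    have : β j = ∑ i, Q i j * β j := by rw [← Finset.sum_mul, hcol, one_mul]
    conv_lhs => enter [1]; rw [this]
    rw [← Finset.sum_sub_distrib]
    exact Finset.sum_congr rfl fun i _ => by ring
  -- Jensen's inequality for the probability weights in column `j`.
  have h2 : ∀ j, (∑ i, Q i j * (μ i + φ i j)) ^ 2 ≤ ∑ i, Q i j * (μ i + φ i j) ^ 2 := fun j => by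
    have := Finset.sum_sq_le_sum_mul_sum_of_sq_le_mul Finset.univ
      (r := fun i => Q i j * (μ i + φ i j)) (f := fun i => Q i j)
      (g := fun i => Q i j * (μ i + φ i j) ^ 2) (fun i _ => hQ i j)
      (fun i _ => mul_nonneg (hQ i j) (sq_nonneg _)) (fun i _ => le_of_eq (by ring))
    rwa [hcol, one_mul] at this
  -- The cross term vanishes because `φ` has mean zero in each row, so the error enters only
  -- quadratically.
  have h3 : ∀ i, ∑ j, Q i j * (μ i + φ i j) ^ 2 = μ i ^ 2 + ∑ j, Q i j * φ i j ^ 2 := fun i => by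
    have : ∑ j, Q i j * (μ i + φ i j) ^ 2 =
        μ i ^ 2 * ∑ j, Q i j + 2 * μ i * ∑ j, Q i j * φ i j + ∑ j, Q i j * φ i j ^ 2 := by
      simp only [Finset.mul_sum]
      rw [← Finset.sum_add_distrib, ← Finset.sum_add_distrib]
      exact Finset.sum_congr rfl fun j _ => by ring
    rw [this, hrow, hφ]
    ring
  calc _ = ∑ j, (∑ i, Q i j * (μ i + φ i j)) ^ 2 := Finset.sum_congr rfl fun j _ => by rw [← h1]
    _ ≤ ∑ j, ∑ i, Q i j * (μ i + φ i j) ^ 2 := Finset.sum_le_sum fun j _ => h2 j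
    _ = ∑ i, (μ i ^ 2 + ∑ j, Q i j * φ i j ^ 2) := by
      rw [Finset.sum_comm]
      exact Finset.sum_congr rfl fun i _ => h3 i
    _ = _ := by
      rw [rowVariance_eq hrow hcol, Finset.sum_add_distrib]
      ring

end Sinkhorn

theorem dotProduct_sq_le {n : ℕ} (a b : Fin n → ℝ) : (a ⬝ᵥ b) ^ 2 ≤ (a ⬝ᵥ a) * (b ⬝ᵥ b) := by
  simpa [dotProduct, sq] using Finset.sum_mul_sq_le_sq_mul_sq Finset.univ a b

theorem dotProduct_self_sum_smul_le {n : ℕ} {ι : Type*} (s : Finset ι) {q : ι → ℝ}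
    (hq : ∀ j ∈ s, 0 ≤ q j) (a : ι → ℝ) (y : ι → Fin n → ℝ) :
    (∑ j ∈ s, (q j * a j) • y j) ⬝ᵥ (∑ j ∈ s, (q j * a j) • y j) ≤
      (∑ j ∈ s, q j * a j ^ 2) * ∑ j ∈ s, q j * (y j ⬝ᵥ y j) := by
  have h1 : ∑ j ∈ s, q j * (y j ⬝ᵥ y j) = ∑ l, ∑ j ∈ s, q j * y j l ^ 2 := by
    rw [Finset.sum_comm]
    refine Finset.sum_congr rfl fun j _ => ?_
    rw [dotProduct, Finset.mul_sum]
    exact Finset.sum_congr rfl fun l _ => by ring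
  rw [h1, Finset.mul_sum, dotProduct]
  refine Finset.sum_le_sum fun l _ => ?_
  rw [← sq, Finset.sum_apply]
  exact Finset.sum_sq_le_sum_mul_sum_of_sq_le_mul s
    (fun j hj => mul_nonneg (hq j hj) (sq_nonneg _))
    (fun j hj => mul_nonneg (hq j hj) (sq_nonneg _))
    (fun j _ => le_of_eq (by simp only [Pi.smul_apply, smul_eq_mul]; ring))

/-! ### Coupling estimates and the joint Lyapunov function -/

namespace AgentSystem

open Sinkhorn

variable {N n m : ℕ}

/-- The total variance of the targets around the states under the rows of `Q`. -/
noncomputable def spread (S : AgentSystem N n m) (Q : Fin N → Fin N → ℝ)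
    (x : Fin N → Fin n → ℝ) : ℝ :=
  ∑ i, ∑ j, Q i j * ((x i - S.target j) ⬝ᵥ (x i - S.target j))

/-- The part of the derivative of `Cᵢⱼ(x) / ε` that depends on `j`, in direction `ξ`. -/
noncomputable def costDeriv (S : AgentSystem N n m) (ε : ℝ) (x ξ : Fin N → Fin n → ℝ)
    (i j : Fin N) : ℝ :=
  2 / ε * ((x i - S.target j) ⬝ᵥ (S.costWeight i *ᵥ ξ i))

theorem sum_smul_sub_target (S : AgentSystem N n m) {Q : Fin N → Fin N → ℝ}
    {x : Fin N → Fin n → ℝ} (hrow : ∀ i, ∑ j, Q i j = 1)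
    (hx : ∀ i, x i = ∑ j, Q i j • S.target j) (i : Fin N) :
    ∑ j, Q i j • (x i - S.target j) = 0 := by
  simp only [smul_sub, Finset.sum_sub_distrib]
  rw [← Finset.sum_smul, hrow, one_smul, ← hx, sub_self]

theorem sum_mul_costDeriv (S : AgentSystem N n m) (ε : ℝ) {Q : Fin N → Fin N → ℝ}
    {x : Fin N → Fin n → ℝ} (hrow : ∀ i, ∑ j, Q i j = 1)
    (hx : ∀ i, x i = ∑ j, Q i j • S.target j) (ξ : Fin N → Fin n → ℝ) (i : Fin N) :
    ∑ j, Q i j * S.costDeriv ε x ξ i j = 0 := by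
  have : ∑ j, Q i j * S.costDeriv ε x ξ i j =
      2 / ε * ((∑ j, Q i j • (x i - S.target j)) ⬝ᵥ (S.costWeight i *ᵥ ξ i)) := by
    rw [sum_dotProduct, Finset.mul_sum]
    refine Finset.sum_congr rfl fun j _ => ?_
    rw [costDeriv, smul_dotProduct, smul_eq_mul]
    ring
  rw [this, S.sum_smul_sub_target hrow hx, zero_dotProduct, mul_zero]

theorem spread_nonneg (S : AgentSystem N n m) {Q : Fin N → Fin N → ℝ} (hQ : ∀ i j, 0 ≤ Q i j)
    (x : Fin N → Fin n → ℝ) : 0 ≤ S.spread Q x :=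
  Finset.sum_nonneg fun i _ => Finset.sum_nonneg fun j _ =>
    mul_nonneg (hQ i j) (dotProduct_self_nonneg_real _)

theorem sum_row_le_spread (S : AgentSystem N n m) {Q : Fin N → Fin N → ℝ}
    (hQ : ∀ i j, 0 ≤ Q i j) (x : Fin N → Fin n → ℝ) (i : Fin N) :
    ∑ j, Q i j * ((x i - S.target j) ⬝ᵥ (x i - S.target j)) ≤ S.spread Q x :=
  Finset.single_le_sum (f := fun i => ∑ j, Q i j * ((x i - S.target j) ⬝ᵥ (x i - S.target j)))
    (fun i _ => Finset.sum_nonneg fun j _ => mul_nonneg (hQ i j) (dotProduct_self_nonneg_real _))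
    (Finset.mem_univ i)

theorem sum_mul_costDeriv_sq_le (S : AgentSystem N n m) (ε : ℝ) {Q : Fin N → Fin N → ℝ}
    (hQ : ∀ i j, 0 ≤ Q i j) (x : Fin N → Fin n → ℝ) {g : ℝ} (hg0 : 0 ≤ g)
    (hg : ∀ i v, (S.costWeight i *ᵥ v) ⬝ᵥ (S.costWeight i *ᵥ v) ≤ g * (v ⬝ᵥ v))
    (ξ : Fin N → Fin n → ℝ) :
    ∑ i, ∑ j, Q i j * S.costDeriv ε x ξ i j ^ 2 ≤
      (2 / ε) ^ 2 * S.spread Q x * g * ∑ i, ξ i ⬝ᵥ ξ i := by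
  rw [Finset.mul_sum]
  refine Finset.sum_le_sum fun i _ => ?_
  calc ∑ j, Q i j * S.costDeriv ε x ξ i j ^ 2
      ≤ ∑ j, (2 / ε) ^ 2 * (g * (ξ i ⬝ᵥ ξ i)) *
          (Q i j * ((x i - S.target j) ⬝ᵥ (x i - S.target j))) := by
        refine Finset.sum_le_sum fun j _ => ?_
        rw [costDeriv, mul_pow]
        have h1 := dotProduct_sq_le (x i - S.target j) (S.costWeight i *ᵥ ξ i)
        have h2 := mul_le_mul_of_nonneg_left (hg i (ξ i))
          (dotProduct_self_nonneg_real (x i - S.target j))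
        have h3 := mul_le_mul_of_nonneg_left (h1.trans h2)
          (mul_nonneg (hQ i j) (sq_nonneg (2 / ε)))
        linarith
    _ = (2 / ε) ^ 2 * (g * (ξ i ⬝ᵥ ξ i)) *
          ∑ j, Q i j * ((x i - S.target j) ⬝ᵥ (x i - S.target j)) := by rw [Finset.mul_sum]
    _ ≤ (2 / ε) ^ 2 * (g * (ξ i ⬝ᵥ ξ i)) * S.spread Q x := by
        have := dotProduct_self_nonneg_real (ξ i)
        gcongr
        exact S.sum_row_le_spread hQ x i
    _ = _ := by ring

/-- At a barycentre the cost derivative has row mean zero, so only the mean of `β` is subtracted. -/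
theorem planDeriv_eq (S : AgentSystem N n m) (ε : ℝ) {x : Fin N → Fin n → ℝ} {b : Fin N → ℝ}
    (hx : ∀ i, x i = ∑ j, softPlan (S.costMatrix x) ε b i j • S.target j)
    (ξ : Fin N → Fin n → ℝ) (β : Fin N → ℝ) (i j : Fin N) :
    S.planDeriv ε x b ξ β i j = softPlan (S.costMatrix x) ε b i j *
      (β j - ∑ k, softPlan (S.costMatrix x) ε b i k * β k - S.costDeriv ε x ξ i j) := by
  have h := S.sum_mul_costDeriv ε (sum_softPlan (S.costMatrix x) ε b) hx ξ i
  have hl : ∀ j, S.logitDeriv ε x ξ β i j = β j - S.costDeriv ε x ξ i j := fun _ => rfl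
  simp only [planDeriv, hl, mul_sub, Finset.sum_sub_distrib, h]
  ring

/-- The rows of the plan derivative sum to zero, so targets may be replaced by their deviations from
the states. Weighted Cauchy–Schwarz then extracts a factor of the spread. -/
theorem sum_tempTarget_deriv_le (S : AgentSystem N n m) (ε : ℝ) {x : Fin N → Fin n → ℝ}
    {b : Fin N → ℝ} (hx : ∀ i, x i = ∑ j, softPlan (S.costMatrix x) ε b i j • S.target j)
    {g : ℝ} (hg0 : 0 ≤ g)
    (hg : ∀ i v, (S.costWeight i *ᵥ v) ⬝ᵥ (S.costWeight i *ᵥ v) ≤ g * (v ⬝ᵥ v))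
    (ξ : Fin N → Fin n → ℝ) (β : Fin N → ℝ) :
    ∑ i, (∑ j, S.planDeriv ε x b ξ β i j • S.target j) ⬝ᵥ
        (∑ j, S.planDeriv ε x b ξ β i j • S.target j) ≤
      2 * S.spread (softPlan (S.costMatrix x) ε b) x *
        (rowVariance (softPlan (S.costMatrix x) ε b) β +
          (2 / ε) ^ 2 * S.spread (softPlan (S.costMatrix x) ε b) x * g * ∑ i, ξ i ⬝ᵥ ξ i) := by
  have hφ := S.sum_mul_costDeriv ε (sum_softPlan (S.costMatrix x) ε b) hx ξ
  have hQ : ∀ i j, 0 ≤ softPlan (S.costMatrix x) ε b i j := fun i j => (softPlan_pos _ _ _ _ _).le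
  have hrow := sum_softPlan (S.costMatrix x) ε b
  have hD0 := S.spread_nonneg hQ x
  have hdrv := S.planDeriv_eq ε hx ξ β
  have hcost := S.sum_mul_costDeriv_sq_le ε hQ x hg0 hg ξ
  generalize softPlan (S.costMatrix x) ε b = Q at *
  set D := S.spread Q x
  set a : Fin N → Fin N → ℝ := fun i j => β j - ∑ k, Q i k * β k - S.costDeriv ε x ξ i j with ha
  have hsum0 : ∀ i, ∑ j, S.planDeriv ε x b ξ β i j = 0 := fun i => by
    simp only [hdrv, mul_sub, Finset.sum_sub_distrib, ← Finset.sum_mul, hrow, hφ]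
    ring
  have hneg : ∀ i, ∑ j, S.planDeriv ε x b ξ β i j • S.target j =
      -∑ j, (Q i j * a i j) • (x i - S.target j) := fun i => by
    simp only [ha, ← hdrv, smul_sub, Finset.sum_sub_distrib]
    rw [← Finset.sum_smul, hsum0, zero_smul, zero_sub, neg_neg]
  have hi : ∀ i, (∑ j, S.planDeriv ε x b ξ β i j • S.target j) ⬝ᵥ
      (∑ j, S.planDeriv ε x b ξ β i j • S.target j) ≤ (∑ j, Q i j * a i j ^ 2) * D := fun i => by
    rw [hneg, neg_dotProduct_neg]
    refine (dotProduct_self_sum_smul_le Finset.univ (fun j _ => hQ i j) (a i) _).trans ?_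
    exact mul_le_mul_of_nonneg_left (S.sum_row_le_spread hQ x i)
      (Finset.sum_nonneg fun j _ => mul_nonneg (hQ i j) (sq_nonneg _))
  have ha2 : ∑ i, ∑ j, Q i j * a i j ^ 2 ≤
      2 * (rowVariance Q β + ∑ i, ∑ j, Q i j * S.costDeriv ε x ξ i j ^ 2) := by
    rw [rowVariance, ← Finset.sum_add_distrib, Finset.mul_sum]
    refine Finset.sum_le_sum fun i _ => ?_
    rw [← Finset.sum_add_distrib, Finset.mul_sum]
    refine Finset.sum_le_sum fun j _ => ?_
    simp only [ha]
    generalize β j - ∑ k, Q i k * β k = p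
    generalize S.costDeriv ε x ξ i j = q
    have := mul_nonneg (hQ i j) (sq_nonneg (p + q))
    linarith
  calc _ ≤ ∑ i, (∑ j, Q i j * a i j ^ 2) * D := Finset.sum_le_sum fun i _ => hi i
    _ = (∑ i, ∑ j, Q i j * a i j ^ 2) * D := by rw [Finset.sum_mul]
    _ ≤ (2 * (rowVariance Q β + (2 / ε) ^ 2 * D * g * ∑ i, ξ i ⬝ᵥ ξ i)) * D := by
      gcongr
      linarith
    _ = _ := by ring

/-- The equilibria with small enough spread, relative to `ε`, are asymptotically stable. -/
theorem exists_stable_of_spread_le (S : AgentSystem N n m) (hS : S.Reachable)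
    (hA : ∀ i, IsUnit (S.A i)) (D₀ : ℝ) : ∃ η > 0, ∀ (ε : ℝ)
      (x : Fin N → Fin n → ℝ) (b : Fin N → ℝ), S.logDynamics ε (x, b) = (x, b) →
      (∀ j, ∑ i, softPlan (S.costMatrix x) ε b i j = 1) →
      (∀ i, x i = ∑ j, softPlan (S.costMatrix x) ε b i j • S.target j) →
      S.spread (softPlan (S.costMatrix x) ε b) x ≤ D₀ →
      2 / ε * S.spread (softPlan (S.costMatrix x) ε b) x ≤ η → 0 ≤ 2 / ε →
      (2 / ε) ^ 2 * S.spread (softPlan (S.costMatrix x) ε b) x ≤ η →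
      IsLocallyAsymptoticallyStable (S.dynamics ε) (x, expClass b) := by
  choose H hHc hHh hHp c' hc' C' hC' hH using fun i => S.exists_lyapunov hS i (hA i)
  have hdp : ∀ v : Fin n → ℝ, v ≠ 0 → 0 < v ⬝ᵥ v := fun v hv =>
    lt_of_le_of_ne (dotProduct_self_nonneg_real v) fun h => hv (dotProduct_self_eq_zero.mp h.symm)
  have hdh : ∀ (t : ℝ) (v : Fin n → ℝ), (t • v) ⬝ᵥ (t • v) = t ^ 2 * (v ⬝ᵥ v) := fun t v => by
    simp only [dotProduct_smul, smul_dotProduct, smul_eq_mul]; ring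
  choose g' hg'1 hg' using fun i => exists_le_mul_of_homogeneous
    (f := fun v => (S.costWeight i *ᵥ v) ⬝ᵥ (S.costWeight i *ᵥ v)) (g := fun v => v ⬝ᵥ v)
    (by fun_prop) (by fun_prop) (fun t v => by simp only [Matrix.mulVec_smul, hdh]) hdh hdp
  choose B' hB'1 hB' using fun i => exists_le_mul_of_homogeneous
    (f := fun p : (Fin n → ℝ) × (Fin n → ℝ) =>
      (S.closedLoop i *ᵥ p.1 + (1 - S.closedLoop i) *ᵥ p.2) ⬝ᵥ
        (S.closedLoop i *ᵥ p.1 + (1 - S.closedLoop i) *ᵥ p.2))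
    (g := fun p => p.1 ⬝ᵥ p.1 + p.2 ⬝ᵥ p.2) (by fun_prop) (by fun_prop)
    (fun t p => by simp only [Prod.smul_fst, Prod.smul_snd, Matrix.mulVec_smul, ← smul_add, hdh])
    (fun t p => by simp only [Prod.smul_fst, Prod.smul_snd, hdh]; ring) (fun p hp => by
      have h1 := dotProduct_self_nonneg_real p.1
      have h2 := dotProduct_self_nonneg_real p.2
      by_cases h : p.1 = 0
      · have : p.2 ≠ 0 := fun h' => hp (Prod.ext h h')
        linarith [hdp _ this]
      · linarith [hdp _ h])
  obtain ⟨c, hci, hc⟩ : ∃ c : ℝ, (∀ i, c ≤ c' i) ∧ 0 < c :=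
    ((eventually_all.mpr fun i => (eventually_le_nhds (hc' i)).filter_mono nhdsWithin_le_nhds).and
      (self_mem_nhdsWithin (s := Set.Ioi (0 : ℝ)))).exists
  obtain ⟨C, hCi, hgi, hBi, hC⟩ :
      ∃ C : ℝ, (∀ i, C' i ≤ C) ∧ (∀ i, g' i ≤ C) ∧ (∀ i, B' i ≤ C) ∧ 0 < C :=
    ((eventually_all.mpr fun i => eventually_ge_atTop (C' i)).and
      ((eventually_all.mpr fun i => eventually_ge_atTop (g' i)).and
        ((eventually_all.mpr fun i => eventually_ge_atTop (B' i)).and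
          (eventually_gt_atTop 0)))).exists
  have hg : ∀ i v, (S.costWeight i *ᵥ v) ⬝ᵥ (S.costWeight i *ᵥ v) ≤ C * (v ⬝ᵥ v) := fun i v =>
    (hg' i v).trans (mul_le_mul_of_nonneg_right (hgi i) (dotProduct_self_nonneg_real v))
  -- A small weight on the agents lets the variance lost by `β` pay for the disturbance it causes in
  -- them. Only then is `η` chosen, small relative to `κ`, so that the feedback from the agents to
  -- `β` is absorbed by `κ c`.
  obtain ⟨κ, hκ, hκ0⟩ : ∃ κ : ℝ, 2 * D₀ * (κ * C) < 1 ∧ 0 < κ := by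
    have ht : Tendsto (fun κ : ℝ => 2 * D₀ * (κ * C)) (𝓝 0) (𝓝 0) := by
      have : Continuous fun κ : ℝ => 2 * D₀ * (κ * C) := by fun_prop
      simpa using this.tendsto 0
    exact (((ht.eventually_lt_const one_pos).filter_mono nhdsWithin_le_nhds).and
      (self_mem_nhdsWithin (s := Set.Ioi (0 : ℝ)))).exists
  obtain ⟨η, ⟨hη₁, hη₂⟩, hη⟩ : ∃ η : ℝ, (2 * D₀ * (κ * C + η * C * C) < 1 ∧
      2 * C * η ^ 2 * (κ * C + η * C * C) + η * C * C < κ * c) ∧ 0 < η := by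
    have h1 : Continuous fun η : ℝ => 2 * D₀ * (κ * C + η * C * C) := by fun_prop
    have h2 : Continuous fun η : ℝ => 2 * C * η ^ 2 * (κ * C + η * C * C) + η * C * C := by
      fun_prop
    exact ((((h1.tendsto 0).eventually_lt_const (by simpa using hκ)).and
      ((h2.tendsto 0).eventually_lt_const (by simpa using mul_pos hκ0 hc))).filter_mono
        nhdsWithin_le_nhds |>.and (self_mem_nhdsWithin (s := Set.Ioi (0 : ℝ)))).exists
  refine ⟨η, hη, fun ε x b hfix hcol hx hD hsD hs hssD => ?_⟩
  set Q := softPlan (S.costMatrix x) ε b with hQdef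
  have hQpos : ∀ i j, 0 < Q i j := softPlan_pos (S.costMatrix x) ε b
  have hQ : ∀ i j, 0 ≤ Q i j := fun i j => (hQpos i j).le
  have hrow : ∀ i, ∑ j, Q i j = 1 := sum_softPlan (S.costMatrix x) ε b
  set D := S.spread Q x with hDdef
  have hDnn : 0 ≤ D := S.spread_nonneg hQ x
  obtain ⟨L, hL⟩ := S.differentiable_logDynamics ε (x, b)
  have hLv : ∀ v, L v = S.linDynamics ε x b v := fun v =>
    (hL.hasLineDerivAt v).unique (S.hasLineDerivAt_logDynamics ε hfix hcol v)
  set W : (Fin N → Fin n → ℝ) × (Fin N → ℝ) → ℝ :=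
    fun v => κ * ∑ i, H i (v.1 i) + ∑ j, v.2 j ^ 2 with hW
  have hHnn : ∀ i v, 0 ≤ H i v := fun i v => by
    by_cases hv : v = 0
    · have := hHh i 0 0
      simp at this
      rw [hv, this]
    · exact (hHp i v hv).le
  have hWp : ∀ v, v ≠ 0 → 0 < W v := by
    intro v hv
    have h1 : 0 ≤ κ * ∑ i, H i (v.1 i) :=
      mul_nonneg hκ0.le (Finset.sum_nonneg fun i _ => hHnn i _)
    have h2 : 0 ≤ ∑ j, v.2 j ^ 2 := Finset.sum_nonneg fun j _ => sq_nonneg _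
    by_cases h : v.1 = 0
    · have h' : v.2 ≠ 0 := fun h' => hv (Prod.ext h h')
      obtain ⟨j, hj⟩ := Function.ne_iff.mp h'
      have : 0 < ∑ j, v.2 j ^ 2 := Finset.sum_pos' (fun j _ => sq_nonneg _)
        ⟨j, Finset.mem_univ j, sq_pos_of_ne_zero hj⟩
      simp only [hW]
      linarith
    · obtain ⟨i, hi⟩ := Function.ne_iff.mp h
      have : 0 < ∑ i, H i (v.1 i) := Finset.sum_pos' (fun i _ => hHnn i _)
        ⟨i, Finset.mem_univ i, hHp i _ hi⟩
      have := mul_pos hκ0 this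
      simp only [hW]
      linarith
  have hdec : ∀ v, v ≠ 0 → W (L v) < W v := by
    intro v hv
    set X := ∑ i, v.1 i ⬝ᵥ v.1 i with hX
    set t : Fin N → Fin n → ℝ := fun i => ∑ j, S.planDeriv ε x b v.1 v.2 i j • S.target j with ht
    set T := ∑ i, t i ⬝ᵥ t i with hT
    set ζ := S.linState ε x b v with hζ
    have hζi : ∀ i, ζ i = S.closedLoop i *ᵥ v.1 i + (1 - S.closedLoop i) *ᵥ t i := fun _ => rfl
    have hXnn : 0 ≤ X := Finset.sum_nonneg fun i _ => dotProduct_self_nonneg_real _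
    have hTnn : 0 ≤ T := Finset.sum_nonneg fun i _ => dotProduct_self_nonneg_real _
    have hlnn := rowVariance_nonneg hQ v.2
    set l := rowVariance Q v.2 with hl
    have hTle : T ≤ 2 * D₀ * l + 2 * C * η ^ 2 * X := by
      refine (S.sum_tempTarget_deriv_le ε hx hC.le hg v.1 v.2).trans ?_
      rw [← hQdef, ← hDdef, ← hl, ← hX]
      have h1 : (2 / ε * D) ^ 2 ≤ η ^ 2 := by gcongr
      have h2 := mul_le_mul_of_nonneg_right hD hlnn
      have h3 := mul_le_mul_of_nonneg_right h1 (mul_nonneg hC.le hXnn)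
      calc _ = 2 * (D * l) + 2 * ((2 / ε * D) ^ 2 * (C * X)) := by ring
        _ ≤ 2 * (D₀ * l) + 2 * (η ^ 2 * (C * X)) := by linarith
        _ = _ := by ring
    have hHle : ∑ i, H i (ζ i) ≤ ∑ i, H i (v.1 i) - c * X + C * T := by
      rw [hX, hT, Finset.mul_sum, Finset.mul_sum, ← Finset.sum_sub_distrib,
        ← Finset.sum_add_distrib]
      refine Finset.sum_le_sum fun i _ => ?_
      rw [hζi]
      have h1 := hH i (v.1 i) (t i)
      have h2 := mul_le_mul_of_nonneg_right (hci i) (dotProduct_self_nonneg_real (v.1 i))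
      have h3 := mul_le_mul_of_nonneg_right (hCi i) (dotProduct_self_nonneg_real (t i))
      linarith
    have hZle : ∑ i, ζ i ⬝ᵥ ζ i ≤ C * (X + T) := by
      rw [hX, hT, ← Finset.sum_add_distrib, Finset.mul_sum]
      refine Finset.sum_le_sum fun i _ => ?_
      rw [hζi]
      exact (hB' i (v.1 i, t i)).trans (mul_le_mul_of_nonneg_right (hBi i)
        (add_nonneg (dotProduct_self_nonneg_real _) (dotProduct_self_nonneg_real _)))
    have hφ := S.sum_mul_costDeriv ε hrow hx ζ
    have hble : ∑ j, (L v).2 j ^ 2 ≤ ∑ j, v.2 j ^ 2 - l + η * C * (C * (X + T)) := by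
      rw [hLv]
      refine (sum_center_sq_le _).trans ?_
      simp only [S.planDeriv_eq ε hx]
      refine (sum_sq_average_le hQ hrow hcol v.2 hφ).trans ?_
      have h1 := S.sum_mul_costDeriv_sq_le ε hQ x hC.le hg ζ
      have hZnn : 0 ≤ ∑ i, ζ i ⬝ᵥ ζ i := Finset.sum_nonneg fun i _ => dotProduct_self_nonneg_real _
      have h2 : (2 / ε) ^ 2 * D * C * ∑ i, ζ i ⬝ᵥ ζ i ≤ η * C * (C * (X + T)) := by gcongr
      linarith
    -- `T` occurs with total weight `κ C + η C²`; inserting `hTle` splits it between `l` and `X`.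
    have hmain : W (L v) ≤ W v - (1 - 2 * D₀ * (κ * C + η * C * C)) * l -
        (κ * c - (2 * C * η ^ 2 * (κ * C + η * C * C) + η * C * C)) * X := by
      have h1 : (L v).1 = ζ := by rw [hLv]; rfl
      simp only [hW, h1]
      have h2 := mul_le_mul_of_nonneg_left hHle hκ0.le
      have h3 := mul_le_mul_of_nonneg_left hTle
        (show 0 ≤ κ * C + η * C * C by positivity)
      linarith
    have hp := sub_pos.mpr hη₁
    have hq := sub_pos.mpr hη₂
    -- The decrease is only semidefinite in `v`. If it vanishes, the agents are at rest and `v.2` is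
    -- constant because `Q` is positive; centring then gives `L v = 0`, while `W v > 0`.
    by_contra! hge
    have hpl := mul_nonneg hp.le hlnn
    have hqX := mul_nonneg hq.le hXnn
    have hl0 : l = 0 := (mul_eq_zero.mp (by linarith : _ * l = 0)).resolve_left hp.ne'
    have hX0 : X = 0 := (mul_eq_zero.mp (by linarith : _ * X = 0)).resolve_left hq.ne'
    have hT0 : T = 0 := by
      rw [hl0, hX0] at hTle
      linarith
    have hζ0 : ζ = 0 := by
      rw [hX0, hT0] at hZle
      have hZ : ∑ i, ζ i ⬝ᵥ ζ i = 0 := le_antisymm (by linarith)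
        (Finset.sum_nonneg fun i _ => dotProduct_self_nonneg_real _)
      funext i
      exact dotProduct_self_eq_zero.mp ((Finset.sum_eq_zero_iff_of_nonneg
        fun i _ => dotProduct_self_nonneg_real _).mp hZ i (Finset.mem_univ i))
    have hconst : ∀ i j, v.2 j = ∑ k, Q i k * v.2 k := fun i j => by
      have h1 := (Finset.sum_eq_zero_iff_of_nonneg fun i _ => Finset.sum_nonneg fun j _ =>
        mul_nonneg (hQ i j) (sq_nonneg _)).mp hl0 i (Finset.mem_univ i)
      have h2 := (Finset.sum_eq_zero_iff_of_nonneg fun j _ =>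
        mul_nonneg (hQ i j) (sq_nonneg _)).mp h1 j (Finset.mem_univ j)
      have h3 := (mul_eq_zero.mp h2).resolve_left (hQpos i j).ne'
      exact sub_eq_zero.mp (pow_eq_zero_iff two_ne_zero |>.mp h3)
    have hLv0 : L v = 0 := by
      rw [hLv]
      refine Prod.ext hζ0 ?_
      have hpd : ∀ i j, S.planDeriv ε x b ζ v.2 i j = 0 := fun i j => by
        rw [S.planDeriv_eq ε hx, ← hQdef, ← hconst i j, hζ0]
        simp [costDeriv]
      funext j
      have hN : (N : ℝ) ≠ 0 := (Nat.cast_pos.mpr (Fin.pos j)).ne'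
      have hall : ∀ k, v.2 k = v.2 j := fun k => by rw [hconst j k, ← hconst j j]
      simp only [linDynamics, ← hζ, hpd, center, Finset.sum_const_zero, sub_zero, hall,
        Finset.sum_const, Finset.card_univ, Fintype.card_fin, nsmul_eq_mul]
      simp [mul_div_cancel_left₀ _ hN]
    have hpos := hWp v hv
    rw [hLv0] at hge
    have hW0 : W 0 = 0 := by
      have : ∀ i, H i 0 = 0 := fun i => by simpa using hHh i 0 0
      simp [hW, this]
    linarith
  have hstab : IsLocallyAsymptoticallyStable (S.logDynamics ε) (x, b) := by
    refine isLocallyAsymptoticallyStable_of_hasFDerivAt hL hfix (W := W) ?_ ?_ hWp hdec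
    · simp only [hW]
      fun_prop
    · intro r v
      simp only [hW, Prod.smul_fst, Prod.smul_snd, Pi.smul_apply, hHh, smul_eq_mul, mul_pow,
        ← Finset.mul_sum]
      ring
  exact hstab.of_semiconj (continuous_id.prodMap continuous_expClass)
    (IsOpenMap.id.prodMap isOpenMap_expClass) (S.semiconj_logDynamics ε)

end AgentSystem

/-! ### Uniqueness in entropic optimal transport -/

namespace Sinkhorn

variable {N : ℕ}

theorem kl_nonneg {p q : ℝ} (hp : 0 ≤ p) (hq : 0 < q) :
    0 ≤ p * (Real.log p - Real.log q) - p + q ∧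
      (p * (Real.log p - Real.log q) - p + q = 0 → p = q) := by
  rcases hp.eq_or_lt with rfl | hp
  · exact ⟨by simpa using hq.le, fun h => by simpa [eq_comm] using h⟩
  · have hlog : Real.log p - Real.log q = -Real.log (q / p) := by
      rw [Real.log_div hq.ne' hp.ne']
      ring
    by_cases h : q / p = 1
    · have hqp : q = p := by rwa [div_eq_one_iff_eq hp.ne'] at h
      simp [hqp]
    · have h1 := mul_lt_mul_of_pos_left (Real.log_lt_sub_one_of_pos (div_pos hq hp) h) hp
      have h2 : p * (q / p - 1) = q - p := by field_simp
      rw [hlog]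
      exact ⟨by linarith, fun h3 => by linarith⟩

/-- Separable potentials have the same integral against every coupling, so they drop out when costs
are compared. -/
theorem sum_coupling_mul {P : Matrix (Fin N) (Fin N) ℝ} (hP : IsCoupling P) (a b : Fin N → ℝ) :
    ∑ i, ∑ j, P i j * (b j - a i) = (∑ j, b j - ∑ i, a i) / N := by
  have h1 : ∑ i, ∑ j, P i j * b j = (∑ j, b j) / N := by
    rw [Finset.sum_comm, Finset.sum_div]
    refine Finset.sum_congr rfl fun j _ => ?_
    rw [← Finset.sum_mul, hP.2.2]
    ring
  have h2 : ∑ i, ∑ j, P i j * a i = (∑ i, a i) / N := by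
    rw [Finset.sum_div]
    refine Finset.sum_congr rfl fun i _ => ?_
    rw [← Finset.sum_mul, hP.2.1]
    ring
  simp only [mul_sub, Finset.sum_sub_distrib, h1, h2, sub_div]

theorem isCoupling_softPlan {C : Matrix (Fin N) (Fin N) ℝ} {ε : ℝ} {b : Fin N → ℝ}
    (hcol : ∀ j, ∑ i, softPlan C ε b i j = 1) :
    IsCoupling (Matrix.of fun i j => 1 / (N : ℝ) * softPlan C ε b i j) :=
  ⟨fun i j => mul_nonneg (by positivity) (softPlan_pos C ε b i j).le,
    fun i => by simp only [Matrix.of_apply, ← Finset.mul_sum, sum_softPlan, mul_one],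
    fun j => by simp only [Matrix.of_apply, ← Finset.mul_sum, hcol, mul_one]⟩

theorem log_softPlan (C : Matrix (Fin N) (Fin N) ℝ) (ε : ℝ) (b : Fin N → ℝ) (i j : Fin N) :
    Real.log (1 / (N : ℝ) * softPlan C ε b i j) =
      b j - C i j / ε - (Real.log N + Real.log (∑ k, Real.exp (b k - C i k / ε))) := by
  have hN : (N : ℝ) ≠ 0 := (Nat.cast_pos.mpr (Fin.pos i)).ne'
  rw [Real.log_mul (one_div_ne_zero hN) (softPlan_pos C ε b i j).ne', softPlan,
    Real.log_div (Real.exp_pos _).ne' (sum_exp_pos i _).ne', Real.log_exp, one_div, Real.log_inv]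
  ring

/-- A doubly stochastic softmax plan is the unique solution of the entropic transport problem. -/
theorem IsEntropicOptimal.eq_softPlan {C P : Matrix (Fin N) (Fin N) ℝ} {ε : ℝ} (hε : 0 < ε)
    (hP : IsEntropicOptimal C ε P) {b : Fin N → ℝ} (hcol : ∀ j, ∑ i, softPlan C ε b i j = 1)
    (i j : Fin N) : P i j = 1 / (N : ℝ) * softPlan C ε b i j := by
  set R : Matrix (Fin N) (Fin N) ℝ := Matrix.of fun i j => 1 / (N : ℝ) * softPlan C ε b i j with hR
  have hRc : IsCoupling R := isCoupling_softPlan hcol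
  have hRpos : ∀ i j, 0 < R i j := fun i j => by
    have hN : (0 : ℝ) < N := Nat.cast_pos.mpr (Fin.pos i)
    exact mul_pos (by positivity) (softPlan_pos C ε b i j)
  set a : Fin N → ℝ :=
    fun i => Real.log N + Real.log (∑ k, Real.exp (b k - C i k / ε)) with ha
  -- On couplings the functional is `ε` times the relative entropy to `R`, up to an additive
  -- constant; this uses that `log R + C / ε` is separable.
  have hcost : ∀ Q : Matrix (Fin N) (Fin N) ℝ, IsCoupling Q → entropicCost C ε Q =
      ε * ((∑ j, b j - ∑ i, a i) / N + ∑ i, ∑ j, (Q i j * (Real.log (Q i j) -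
        Real.log (R i j)) - Q i j + R i j) - ∑ i, ∑ j, R i j) := fun Q hQ => by
    rw [entropicCost, entropy, ← sum_coupling_mul hQ, mul_neg, sub_neg_eq_add,
      ← Finset.sum_add_distrib, ← Finset.sum_sub_distrib, Finset.mul_sum, Finset.mul_sum,
      ← Finset.sum_add_distrib]
    refine Finset.sum_congr rfl fun i _ => ?_
    rw [← Finset.sum_add_distrib, ← Finset.sum_sub_distrib, Finset.mul_sum, Finset.mul_sum,
      ← Finset.sum_add_distrib]
    refine Finset.sum_congr rfl fun j _ => ?_
    have h1 : Real.log (R i j) = b j - C i j / ε - a i := log_softPlan C ε b i j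
    rw [h1]
    field_simp
    ring
  have hkl : ∀ i j, 0 ≤ P i j * (Real.log (P i j) - Real.log (R i j)) - P i j + R i j :=
    fun i j => (kl_nonneg (hP.1.1 i j) (hRpos i j)).1
  have hle := hP.2 R hRc
  rw [hcost P hP.1, hcost R hRc, mul_le_mul_iff_right₀ hε] at hle
  simp only [sub_self, mul_zero, zero_sub, neg_add_cancel, Finset.sum_const_zero] at hle
  have hzero : ∑ i, ∑ j, (P i j * (Real.log (P i j) - Real.log (R i j)) - P i j + R i j) = 0 :=
    le_antisymm (by linarith) (Finset.sum_nonneg fun i _ => Finset.sum_nonneg fun j _ => hkl i j)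
  have h1 := (Finset.sum_eq_zero_iff_of_nonneg fun i _ =>
    Finset.sum_nonneg fun j _ => hkl i j).mp hzero i (Finset.mem_univ i)
  have h2 := (Finset.sum_eq_zero_iff_of_nonneg fun j _ => hkl i j).mp h1 j (Finset.mem_univ j)
  exact (kl_nonneg (hP.1.1 i j) (hRpos i j)).2 h2

end Sinkhorn

/-! ### Bounds for the spread at equilibria -/

namespace AgentSystem

open Sinkhorn

variable {N n m : ℕ}

theorem abs_sub_target_le (S : AgentSystem N n m) {Q : Fin N → Fin N → ℝ} {x : Fin N → Fin n → ℝ}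
    (hQ : ∀ i j, 0 ≤ Q i j) (hrow : ∀ i, ∑ j, Q i j = 1)
    (hx : ∀ i, x i = ∑ j, Q i j • S.target j) (i j : Fin N) (l : Fin n) :
    |x i l - S.target j l| ≤ 2 * ∑ k, |S.target k l| := by
  have h1 : ∀ k, |S.target k l| ≤ ∑ k, |S.target k l| := fun k =>
    Finset.single_le_sum (f := fun k => |S.target k l|) (fun k _ => abs_nonneg _)
      (Finset.mem_univ k)
  have h2 : |x i l| ≤ ∑ k, |S.target k l| := by
    rw [hx i, Finset.sum_apply]
    refine (Finset.abs_sum_le_sum_abs _ _).trans ?_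
    calc _ ≤ ∑ k, Q i k * ∑ k, |S.target k l| := by
          refine Finset.sum_le_sum fun k _ => ?_
          rw [Pi.smul_apply, smul_eq_mul, abs_mul, abs_of_nonneg (hQ i k)]
          exact mul_le_mul_of_nonneg_left (h1 k) (hQ i k)
      _ = _ := by rw [← Finset.sum_mul, hrow, one_mul]
  have h3 := abs_sub (x i l) (S.target j l)
  linarith [h1 j]

theorem entry_le_one {Q : Fin N → Fin N → ℝ} (hQ : ∀ i j, 0 ≤ Q i j)
    (hrow : ∀ i, ∑ j, Q i j = 1) (i j : Fin N) : Q i j ≤ 1 :=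
  hrow i ▸ Finset.single_le_sum (f := fun j => Q i j) (fun j _ => hQ i j) (Finset.mem_univ j)

theorem spread_le (S : AgentSystem N n m) {Q : Fin N → Fin N → ℝ} {x : Fin N → Fin n → ℝ}
    (hQ : ∀ i j, 0 ≤ Q i j) (hrow : ∀ i, ∑ j, Q i j = 1)
    (hx : ∀ i, x i = ∑ j, Q i j • S.target j) :
    S.spread Q x ≤ ∑ _i : Fin N, ∑ _j : Fin N, ∑ l, (2 * ∑ k, |S.target k l|) ^ 2 := by
  refine Finset.sum_le_sum fun i _ => Finset.sum_le_sum fun j _ => ?_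
  refine (mul_le_of_le_one_left (dotProduct_self_nonneg_real _) (entry_le_one hQ hrow i j)).trans ?_
  refine Finset.sum_le_sum fun l _ => ?_
  rw [← sq, ← sq_abs]
  exact pow_le_pow_left₀ (abs_nonneg _) (S.abs_sub_target_le hQ hrow hx i j l) 2

/-- Every summand has one factor of order `f` and bounded remaining factors: the deviation from the
target when `j = σ i`, the plan entry otherwise. -/
theorem isBigO_spread (S : AgentSystem N n m) {Q : ℝ → Fin N → Fin N → ℝ}
    {x : ℝ → Fin N → Fin n → ℝ} (hQ : ∀ ε, 0 < ε → ∀ i j, 0 ≤ Q ε i j)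
    (hrow : ∀ ε, 0 < ε → ∀ i, ∑ j, Q ε i j = 1)
    (hx : ∀ ε, 0 < ε → ∀ i, x ε i = ∑ j, Q ε i j • S.target j) (σ : Equiv.Perm (Fin N))
    {f : ℝ → ℝ}
    (hxσ : ∀ i l, (fun ε => x ε i l - S.target (σ i) l) =O[𝓝[>] 0] f)
    (hQσ : ∀ i j, j ≠ σ i → (fun ε => Q ε i j) =O[𝓝[>] 0] f) :
    (fun ε => S.spread (Q ε) (x ε)) =O[𝓝[>] 0] f := by
  have hev : ∀ᶠ ε : ℝ in 𝓝[>] 0, 0 < ε := self_mem_nhdsWithin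
  have hy1 : ∀ i j l, (fun ε => x ε i l - S.target j l) =O[𝓝[>] 0] fun _ => (1 : ℝ) :=
    fun i j l => IsBigO.of_bound (2 * ∑ k, |S.target k l|) (hev.mono fun ε hε => by
      simpa using S.abs_sub_target_le (hQ ε hε) (hrow ε hε) (hx ε hε) i j l)
  have hQ1 : ∀ i j, (fun ε => Q ε i j) =O[𝓝[>] 0] fun _ => (1 : ℝ) :=
    fun i j => IsBigO.of_bound 1 (hev.mono fun ε hε => by
      simpa [abs_of_nonneg (hQ ε hε i j)] using entry_le_one (hQ ε hε) (hrow ε hε) i j)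
  unfold spread
  refine IsBigO.fun_sum fun i _ => IsBigO.fun_sum fun j _ => ?_
  by_cases hj : j = σ i
  · subst hj
    have h1 : (fun ε => (x ε i - S.target (σ i)) ⬝ᵥ (x ε i - S.target (σ i))) =O[𝓝[>] 0] f :=
      IsBigO.fun_sum fun l _ => by simpa using (hxσ i l).mul (hy1 i (σ i) l)
    simpa using (hQ1 i (σ i)).mul h1
  · have h1 : (fun ε => (x ε i - S.target j) ⬝ᵥ (x ε i - S.target j)) =O[𝓝[>] 0]
        fun _ => (1 : ℝ) :=
      IsBigO.fun_sum fun l _ => by simpa using (hy1 i j l).mul (hy1 i j l)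
    simpa using (hQσ i j hj).mul h1

theorem tendsto_sq_mul_exp_neg_div {c : ℝ} (hc : 0 < c) :
    Tendsto (fun ε : ℝ => (2 / ε) ^ 2 * Real.exp (-c / ε)) (𝓝[>] 0) (𝓝 0) := by
  have h1 : Tendsto (fun ε : ℝ => c * ε⁻¹) (𝓝[>] 0) atTop :=
    tendsto_inv_nhdsGT_zero.const_mul_atTop hc
  have h2 := ((Real.tendsto_pow_mul_exp_neg_atTop_nhds_zero 2).comp h1).const_mul ((2 / c) ^ 2)
  rw [mul_zero] at h2
  refine h2.congr fun ε => ?_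
  simp only [Function.comp_apply]
  rw [← mul_assoc, ← mul_pow, show 2 / c * (c * ε⁻¹) = 2 / ε by field_simp,
    show -(c * ε⁻¹) = -c / ε by ring]

end AgentSystem

/-! ### The regimes of large and small `ε` -/

theorem theorem2 {N n m : ℕ} (S : AgentSystem N n m)
    (hS : S.Reachable) (hA : ∀ i, IsUnit (S.A i))
    (z : ℝ → (Fin N → Fin n → ℝ) × ProjCone N) (hz : S.IsEquilibriumFamily z)
    (hiso : ∃ ε' : ℝ, 0 < ε' ∧ IsIsolatedEquilibrium (S.dynamics ε') (z ε')) :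
    (∀ᶠ ε : ℝ in atTop, IsLocallyAsymptoticallyStable (S.dynamics ε) (z ε)) ∧
    ((∀ i j, i ≠ j → S.target i ≠ S.target j) →
      ∀ σ : Equiv.Perm (Fin N), S.ConvergesExponentially z σ →
        ∀ᶠ ε : ℝ in 𝓝[>] 0, IsLocallyAsymptoticallyStable (S.dynamics ε) (z ε)) := by
  -- Positivity of `ε` sits inside the existential so that `b` can be chosen for all real `ε`, with
  -- the irrelevant default `0` otherwise.
  have hb : ∀ ε, ∃ b : Fin N → ℝ, 0 < ε → z ε = ((z ε).1, Sinkhorn.expClass b) ∧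
      S.logDynamics ε ((z ε).1, b) = ((z ε).1, b) ∧
      (∀ j, ∑ i, Sinkhorn.softPlan (S.costMatrix (z ε).1) ε b i j = 1) ∧
      ∀ i, (z ε).1 i = ∑ j, Sinkhorn.softPlan (S.costMatrix (z ε).1) ε b i j • S.target j := fun ε => by
    by_cases hε : 0 < ε
    · obtain ⟨b, hb⟩ := S.exists_logDynamics_eq hS hA (hz ε hε)
      exact ⟨b, fun _ => hb⟩
    · exact ⟨0, fun h => absurd h hε⟩
  choose b hb using hb
  set Q : ℝ → Fin N → Fin N → ℝ := fun ε => Sinkhorn.softPlan (S.costMatrix (z ε).1) ε (b ε) with hQ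
  set D : ℝ → ℝ := fun ε => S.spread (Q ε) (z ε).1 with hD
  have hQnn : ∀ ε i j, 0 ≤ Q ε i j := fun ε i j => (Sinkhorn.softPlan_pos _ _ _ _ _).le
  have hrow : ∀ ε i, ∑ j, Q ε i j = 1 := fun ε => Sinkhorn.sum_softPlan _ _ _
  have hDnn : ∀ ε, 0 ≤ D ε := fun ε => S.spread_nonneg (hQnn ε) _
  set D₀ := ∑ _i : Fin N, ∑ _j : Fin N, ∑ l, (2 * ∑ k, |S.target k l|) ^ 2
  have hD₀ : ∀ ε, 0 < ε → D ε ≤ D₀ := fun ε hε =>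
    S.spread_le (hQnn ε) (hrow ε) (hb ε hε).2.2.2
  obtain ⟨η, hη, hstab⟩ := S.exists_stable_of_spread_le hS hA D₀
  have key : ∀ ε, 0 < ε → 2 / ε * D ε ≤ η → (2 / ε) ^ 2 * D ε ≤ η →
      IsLocallyAsymptoticallyStable (S.dynamics ε) (z ε) := fun ε hε h1 h2 => by
    obtain ⟨hzε, hfix, hcol, hx⟩ := hb ε hε
    rw [hzε]
    exact hstab ε (z ε).1 (b ε) hfix hcol hx (hD₀ ε hε) h1 (by positivity) h2
  refine ⟨?_, fun _ σ => ?_⟩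
  · have h0 : Tendsto (fun ε : ℝ => 2 / ε) atTop (𝓝 0) := tendsto_const_nhds.div_atTop tendsto_id
    have h1 : Tendsto (fun ε : ℝ => 2 / ε * D₀) atTop (𝓝 0) := by simpa using h0.mul_const D₀
    have h2 : Tendsto (fun ε : ℝ => (2 / ε) ^ 2 * D₀) atTop (𝓝 0) := by
      simpa using (h0.pow 2).mul_const D₀
    filter_upwards [eventually_gt_atTop 0, h1.eventually_le_const hη, h2.eventually_le_const hη]
      with ε hε h1 h2
    have hle := hD₀ ε hε
    refine key ε hε (le_trans ?_ h1) (le_trans ?_ h2) <;> gcongr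
  · rintro ⟨P, hP, c, hc, hxσ, hPσ⟩
    have hQσ : ∀ i j, j ≠ σ i → (fun ε => Q ε i j) =O[𝓝[>] 0] fun ε => Real.exp (-c / ε) := by
      intro i j hj
      have hN : (N : ℝ) ≠ 0 := (Nat.cast_pos.mpr (Fin.pos i)).ne'
      refine ((hPσ i j).const_mul_left (N : ℝ)).congr' ?_ EventuallyEq.rfl
      filter_upwards [self_mem_nhdsWithin] with ε hε
      rw [(hP ε hε).eq_softPlan hε (hb ε hε).2.2.1 i j, Sinkhorn.permPlan, Matrix.of_apply, if_neg hj,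
        sub_zero, ← mul_assoc, mul_one_div_cancel hN, one_mul]
    have hO := S.isBigO_spread (fun ε _ => hQnn ε) (fun ε _ => hrow ε)
      (fun ε hε => (hb ε hε).2.2.2) σ hxσ hQσ
    have h2 : Tendsto (fun ε : ℝ => (2 / ε) ^ 2 * D ε) (𝓝[>] 0) (𝓝 0) :=
      ((isBigO_refl (fun ε : ℝ => (2 / ε) ^ 2) _).mul hO).trans_tendsto
        (AgentSystem.tendsto_sq_mul_exp_neg_div hc)
    -- For `ε < 2` one has `2 / ε ≤ (2 / ε)²`, so both smallness conditions follow from the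
    -- quadratic one.
    have h2mem : ∀ᶠ ε : ℝ in 𝓝[>] 0, ε < 2 := (eventually_lt_nhds two_pos).filter_mono
      nhdsWithin_le_nhds
    filter_upwards [self_mem_nhdsWithin, h2.eventually_le_const hη, h2mem] with ε hε h2 hε2
    refine key ε hε (le_trans ?_ h2) h2
    have h1 : 1 ≤ 2 / ε := by
      rw [one_le_div hε]
      exact hε2.le
    exact mul_le_mul_of_nonneg_right (le_self_pow₀ h1 two_ne_zero) (hDnn ε)
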